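/- For a compact set $\Gamma\subset\mathbb{R}^2$ and a point $x\in\mathbb{R}^2$, let $$\Gamma_x=\{u\in\Gamma : [x,u]\cap\Gamma=\{u\}\}$$ be the part of $\Gamma$ visible from $x$, where $[x,u]$ denotes the closed line segment joining $x$ to $u$, and let $\dim_H$ denote Hausdorff dimension. Let $\Gamma\subset\mathbb{R}^2$ be a compact connected set with $\dim_H\Gamma>1$. Then for every real number $s$ with $$\tfrac12+\sqrt{\dim_H\Gamma-\tfrac34}<s\le\dim_H\Gamma,$$ we have $$\dim_H\{x\in\mathbb{R}^2 : \dim_H(\Gamma_x)>s\}\le\frac{\dim_H\Gamma-s}{s-1}.$$ -/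

import Mathlib

/-- The part of `K` visible from `x`: the points `u` of `K` such that the closed segment
joining `x` to `u` meets `K` only at `u`. -/
def visiblePart (K : Set (EuclideanSpace ℝ (Fin 2))) (x : EuclideanSpace ℝ (Fin 2)) :
    Set (EuclideanSpace ℝ (Fin 2)) :=
  {u | u ∈ K ∧ segment ℝ x u ∩ K = {u}}

/-!
Take two viewpoints `x ≠ y` at bounded distance and the set `Z` of all dyadic squares of side `2⁻ᵏ`
that meet bounded pieces of both visible parts `Γ_x` and `Γ_y`. In the coordinates given by the
slopes of the sight lines from `x` and from `y`, consider a box bounded by two sight lines from each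
viewpoint that all reach past it: a connected `Γ` cannot cross its boundary. Hence no square of `Z`
lies deep inside a box bounded by sight lines to others. Such planar sets are almost
one-dimensional, which gives `#Z ≲ k² 2ᵏ / |x - y|`.

Now cover `Γ`, of dimension `d`, by about `2^(dk)` dyadic squares. If the set of viewpoints that see
at least `2^(sk)` of them has positive `t`-dimensional Hausdorff content with `t ≤ 1`, then it
contains, for every `m`, about `2^(tm)` points `P` that form a discrete `t`-dimensional Frostman set
at scale `2⁻ᵐ`. Counting pairs of viewpoints that see a common square, Cauchy-Schwarz yields, up to
factors polynomial in `k` and `m`, `#P 2^(2sk) ≲ 2^(dk) (2^(sk) + 2^(k + m))`. Both terms in the sum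
agree for `m = (s - 1) k`, and then `t (s - 1) ≤ d - s`.
-/

open scoped Finset

/-! ### Lattice sets without walled-in points -/

lemma card_le_of_two_mul_le {α : Type*} (S : Finset α) (f : α → ℤ) (L : ℕ)
    (hpos : ∀ a ∈ S, 0 < f a) (hlt : ∀ a ∈ S, f a < 2 ^ L)
    (hdouble : ∀ a ∈ S, ∀ b ∈ S, a ≠ b → 2 * f a ≤ f b ∨ 2 * f b ≤ f a) : #S ≤ L := by
  have log_lt_log {p q : ℤ} (hp : 0 < p) (hpq : 2 * p ≤ q) :
      Nat.log 2 p.toNat < Nat.log 2 q.toNat := by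
    have hlog : Nat.log 2 (p.toNat * 2) = Nat.log 2 p.toNat + 1 :=
      Nat.log_mul_base one_lt_two (by lia)
    have hmono : Nat.log 2 (p.toNat * 2) ≤ Nat.log 2 q.toNat := Nat.log_mono_right (by lia)
    lia
  rw [← Finset.card_range L]
  refine Finset.card_le_card_of_injOn (fun a => Nat.log 2 (f a).toNat) (fun a ha => ?_)
    fun a ha b hb hab => ?_
  · have h := hlt a ha
    rw [Finset.coe_range, Set.mem_Iio]
    refine Nat.log_lt_of_lt_pow (by have := hpos a ha; lia) ?_
    zify
    rwa [Int.toNat_of_nonneg (hpos a ha).le]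
  · by_contra hne
    rcases hdouble a ha b hb hne with h | h
    · exact (log_lt_log (hpos a ha) h).ne hab
    · exact (log_lt_log (hpos b hb) h).ne' hab

lemma card_le_mul_card_image_of_two_mul_le {α β : Type*} [DecidableEq β] (S : Finset α)
    (g : α → β) (f : α → ℤ) (L : ℕ) (hpos : ∀ a ∈ S, 0 < f a) (hlt : ∀ a ∈ S, f a < 2 ^ L)
    (hdouble : ∀ a ∈ S, ∀ b ∈ S, a ≠ b → g a = g b → 2 * f a ≤ f b ∨ 2 * f b ≤ f a) :
    #S ≤ L * #(S.image g) := by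
  refine Finset.card_le_mul_card_image S L fun i _ => ?_
  refine card_le_of_two_mul_le _ f L (fun a ha => ?_) (fun a ha => ?_) fun a ha b hb hne => ?_
  · exact hpos a (Finset.mem_filter.1 ha).1
  · exact hlt a (Finset.mem_filter.1 ha).1
  · rw [Finset.mem_filter] at ha hb
    exact hdouble a ha.1 b hb.1 hne (ha.2.trans hb.2.symm)

lemma card_filter_forall_le_le_card_image {α β γ : Type*} [DecidableEq β] [PartialOrder γ]
    [DecidableLE γ] (G : Finset α) (g : α → β) (h : α → γ)
    (hinj : ∀ a b, g a = g b → h a = h b → a = b) :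
    #(G.filter fun a => ∀ b ∈ G, g b = g a → h a ≤ h b) ≤ #(G.image g) := by
  refine Finset.card_le_card_of_injOn g (fun a ha => ?_) fun a ha b hb hab => ?_
  · exact Finset.mem_coe.2 (Finset.mem_image_of_mem g (Finset.mem_filter.1 ha).1)
  · rw [Finset.mem_coe, Finset.mem_filter] at ha hb
    exact hinj a b hab (le_antisymm (ha.2 b hb.1 hab.symm) (hb.2 a ha.1 hab))

lemma exists_column_min (G : Finset (ℤ × ℤ)) :
    ∃ B : ℤ → ℤ, ∀ a ∈ G, (a.1, B a.1) ∈ G ∧ B a.1 ≤ a.2 := by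
  classical
  have hmin : ∀ i : ℤ, ∃ m : ℤ, ∀ a ∈ G, a.1 = i → (i, m) ∈ G ∧ m ≤ a.2 := by
    intro i
    rcases (G.filter fun a => a.1 = i).eq_empty_or_nonempty with hempty | hne
    · exact ⟨0, fun a ha hai => absurd hai (Finset.filter_eq_empty_iff.1 hempty ha)⟩
    · obtain ⟨c, hc, hcmin⟩ := Finset.exists_min_image _ Prod.snd hne
      obtain ⟨hcG, rfl⟩ := Finset.mem_filter.1 hc
      exact ⟨c.2, fun a ha hai => ⟨hcG, hcmin a (Finset.mem_filter.2 ⟨ha, hai⟩)⟩⟩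
  choose B hB using hmin
  exact ⟨B, fun a ha => hB a.1 a ha rfl⟩

/-- A point `m` lies strictly inside the box spanned by a corner `p`, a point `q` to the left of
`p` and a point `b` below `p`. -/
structure IsCornered (p q b m : ℤ × ℤ) : Prop where
  snd_eq : q.2 = p.2
  fst_eq : b.1 = p.1
  left_lt : q.1 < m.1
  lt_right : m.1 < p.1
  bot_lt : b.2 < m.2
  lt_top : m.2 < p.2

lemma card_filter_two_mul_le_le (G : Finset (ℤ × ℤ)) (B : ℤ → ℤ) (L : ℕ)
    (hB : ∀ a ∈ G, a.2 - B a.1 < 2 ^ L) :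
    #(G.filter fun a => B a.1 < a.2 ∧ ∀ b ∈ G, b.1 = a.1 → b.2 < a.2 →
      2 * (b.2 - B b.1) ≤ a.2 - B a.1) ≤ L * #(G.image Prod.fst) := by
  refine (card_le_mul_card_image_of_two_mul_le _ Prod.fst (fun a => a.2 - B a.1) L
    (fun a ha => ?_) (fun a ha => ?_) fun a ha b hb hne hab => ?_).trans <|
    Nat.mul_le_mul_left _ <| Finset.card_le_card <|
      Finset.image_subset_image (Finset.filter_subset _ _)
  · exact sub_pos.2 (Finset.mem_filter.1 ha).2.1
  · exact hB a (Finset.mem_filter.1 ha).1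
  · obtain ⟨haG, -, ha⟩ := Finset.mem_filter.1 ha
    obtain ⟨hbG, -, hb⟩ := Finset.mem_filter.1 hb
    rcases lt_trichotomy a.2 b.2 with hlt | heq | hlt
    · exact Or.inl (hb a haG hab hlt)
    · exact absurd (Prod.ext hab heq) hne
    · exact Or.inr (ha b hbG hab.symm hlt)

lemma card_filter_lt_two_mul_le (G : Finset (ℤ × ℤ)) (B : ℤ → ℤ) (L : ℕ)
    (hB : ∀ a ∈ G, (a.1, B a.1) ∈ G ∧ B a.1 ≤ a.2) (hL : ∀ a ∈ G, a.2 - B a.1 < 2 ^ L)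
    (havoid : ∀ p ∈ G, ∀ q ∈ G, ∀ b ∈ G, ∀ m ∈ G, ¬IsCornered p q b m) :
    #(G.filter fun a => (∃ c ∈ G, c.2 = a.2 ∧ c.1 < a.1) ∧
      ∃ b ∈ G, b.1 = a.1 ∧ b.2 < a.2 ∧ a.2 - B a.1 < 2 * (b.2 - B b.1)) ≤
        L * #(G.image Prod.snd) := by
  classical
  have key : ∀ a ∈ G, ∀ c ∈ G, ∀ b ∈ G, ∀ a' ∈ G, c.2 = a.2 → c.1 < a.1 → b.1 = a.1 → b.2 < a.2 →
      a.2 - B a.1 < 2 * (b.2 - B b.1) → a.2 = a'.2 → a.1 < a'.1 →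
        2 * (a'.2 - B a'.1) ≤ a.2 - B a.1 := by
    intro a _ c hc b hb a' ha' hca hclt hba hblt hshort haa' hlt
    have hbase : b.2 ≤ B a'.1 := by
      by_contra! hcon
      exact havoid a' ha' c hc _ (hB a' ha').1 b hb ⟨hca.trans haa', rfl, hba ▸ hclt, hba ▸ hlt,
        hcon, haa' ▸ hblt⟩
    rw [hba] at hshort
    lia
  refine (card_le_mul_card_image_of_two_mul_le _ Prod.snd (fun a => a.2 - B a.1) L
    (fun a ha => ?_) (fun a ha => ?_) fun a ha a' ha' hne haa' => ?_).trans <|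
    Nat.mul_le_mul_left _ <| Finset.card_le_card <|
      Finset.image_subset_image (Finset.filter_subset _ _)
  · obtain ⟨-, -, b, hb, hba, hlt, -⟩ := Finset.mem_filter.1 ha
    have := (hB b hb).2
    rw [hba] at this
    lia
  · exact hL a (Finset.mem_filter.1 ha).1
  · obtain ⟨haG, ⟨c, hc, hca, hclt⟩, b, hb, hba, hblt, hab⟩ := Finset.mem_filter.1 ha
    obtain ⟨haG', ⟨c', hc', hca', hclt'⟩, b', hb', hba', hblt', hab'⟩ := Finset.mem_filter.1 ha'
    rcases lt_trichotomy a.1 a'.1 with hlt | heq | hlt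
    · exact Or.inr (key a haG c hc b hb a' haG' hca hclt hba hblt hab haa' hlt)
    · exact absurd (Prod.ext heq haa') hne
    · exact Or.inl (key a' haG' c' hc' b' hb' a haG hca' hclt' hba' hblt' hab' haa'.symm hlt)

/-- In the column of a point of `G`, call the point long if its height over the lowest point of the
column is at least twice that of all points between them: long points have doubling heights within
each column, and in a set without cornered points the others have doubling heights within each
row. -/
lemma card_le_of_forall_not_isCornered (G : Finset (ℤ × ℤ)) (n L : ℕ)
    (hcol : #(G.image Prod.fst) ≤ n) (hrow : #(G.image Prod.snd) ≤ n)
    (hrange : ∀ a ∈ G, ∀ b ∈ G, a.2 - b.2 < 2 ^ L)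
    (havoid : ∀ p ∈ G, ∀ q ∈ G, ∀ b ∈ G, ∀ m ∈ G, ¬IsCornered p q b m) :
    #G ≤ n * (2 + 2 * L) := by
  classical
  obtain ⟨B, hB⟩ := exists_column_min G
  have hL : ∀ a ∈ G, a.2 - B a.1 < 2 ^ L := fun a ha => hrange a ha _ (hB a ha).1
  set leftmost := G.filter fun a => ∀ b ∈ G, b.2 = a.2 → a.1 ≤ b.1
  set lowest := G.filter fun a => ∀ b ∈ G, b.1 = a.1 → a.2 ≤ b.2
  set long := G.filter fun a => B a.1 < a.2 ∧
    ∀ b ∈ G, b.1 = a.1 → b.2 < a.2 → 2 * (b.2 - B b.1) ≤ a.2 - B a.1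
  set short := G.filter fun a => (∃ c ∈ G, c.2 = a.2 ∧ c.1 < a.1) ∧
    ∃ b ∈ G, b.1 = a.1 ∧ b.2 < a.2 ∧ a.2 - B a.1 < 2 * (b.2 - B b.1)
  have hcover : G ⊆ (leftmost ∪ lowest) ∪ (long ∪ short) := by
    intro a ha
    simp only [leftmost, lowest, long, short, Finset.mem_union, Finset.mem_filter]
    by_contra! hcon
    grind
  have hleftmost : #leftmost ≤ n := (card_filter_forall_le_le_card_image G Prod.snd Prod.fst
    fun a b h₂ h₁ => Prod.ext h₁ h₂).trans hrow
  have hlowest : #lowest ≤ n := (card_filter_forall_le_le_card_image G Prod.fst Prod.snd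
    fun a b h₁ h₂ => Prod.ext h₁ h₂).trans hcol
  have hlong : #long ≤ L * n :=
    (card_filter_two_mul_le_le G B L hL).trans (Nat.mul_le_mul_left _ hcol)
  have hshort : #short ≤ L * n :=
    (card_filter_lt_two_mul_le G B L hB hL havoid).trans (Nat.mul_le_mul_left _ hrow)
  calc #G ≤ _ := Finset.card_le_card hcover
    _ ≤ _ := Finset.card_union_le _ _
    _ ≤ (#leftmost + #lowest) + (#long + #short) :=
      add_le_add (Finset.card_union_le _ _) (Finset.card_union_le _ _)
    _ ≤ (n + n) + (L * n + L * n) := by gcongr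
    _ = n * (2 + 2 * L) := by ring

/-- The cell of `w` is walled in by the columns of `u₁` and `u₃` and the rows of `v₁` and `v₃`, and
these four points lie beyond the corners of the box so formed, where `r` is the order used to
compare coordinates. -/
structure IsWalledIn {α : Type*} (r : α → α → Prop) (u₁ u₃ v₁ v₃ w : α × α) : Prop where
  left : r u₁.1 w.1
  right : r w.1 u₃.1
  bot : r v₁.2 w.2
  top : r w.2 v₃.2
  left_beyond : r v₃.2 u₁.2
  right_beyond : r v₃.2 u₃.2
  bot_beyond : r u₃.1 v₁.1
  top_beyond : r u₃.1 v₃.1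

lemma card_le_of_forall_not_isWalledIn (G : Finset (ℤ × ℤ)) (n L : ℕ)
    (hcol : #(G.image Prod.fst) ≤ n) (hrow : #(G.image Prod.snd) ≤ n)
    (hrange : ∀ a ∈ G, ∀ b ∈ G, a.2 - b.2 < 2 ^ L)
    (havoid : ∀ u₁ ∈ G, ∀ u₃ ∈ G, ∀ v₁ ∈ G, ∀ v₃ ∈ G, ∀ w ∈ G,
      ¬IsWalledIn (· < ·) u₁ u₃ v₁ v₃ w) :
    #G ≤ n * (4 + 2 * L) := by
  classical
  set rightmost := G.filter fun a => ∀ b ∈ G, b.2 = a.2 → b.1 ≤ a.1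
  set highest := G.filter fun a => ∀ b ∈ G, b.1 = a.1 → b.2 ≤ a.2
  set rest := G.filter fun a => (∃ b ∈ G, b.2 = a.2 ∧ a.1 < b.1) ∧ ∃ b ∈ G, b.1 = a.1 ∧ a.2 < b.2
  have hcover : G ⊆ (rightmost ∪ highest) ∪ rest := by
    intro a ha
    simp only [rightmost, highest, rest, Finset.mem_union, Finset.mem_filter]
    by_contra! hcon
    grind
  have hrightmost : #rightmost ≤ n := (card_filter_forall_le_le_card_image (γ := ℤᵒᵈ) G Prod.snd
    (fun a => OrderDual.toDual a.1) fun a b h₂ h₁ => Prod.ext h₁ h₂).trans hrow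
  have hhighest : #highest ≤ n := (card_filter_forall_le_le_card_image (γ := ℤᵒᵈ) G Prod.fst
    (fun a => OrderDual.toDual a.2) fun a b h₁ h₂ => Prod.ext h₁ h₂).trans hcol
  have hsub : rest ⊆ G := Finset.filter_subset _ _
  have hrest : #rest ≤ n * (2 + 2 * L) := by
    refine card_le_of_forall_not_isCornered rest n L
      ((Finset.card_le_card (Finset.image_subset_image hsub)).trans hcol)
      ((Finset.card_le_card (Finset.image_subset_image hsub)).trans hrow)
      (fun a ha b hb => hrange a (hsub ha) b (hsub hb)) fun p hp q hq b hb m hm h => ?_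
    obtain ⟨-, ⟨v₃, hv₃, hv₃p, hpv₃⟩, u₃, hu₃, hu₃p, hpu₃⟩ := Finset.mem_filter.1 hp
    obtain ⟨-, -, u₁, hu₁, hu₁q, hqu₁⟩ := Finset.mem_filter.1 hq
    obtain ⟨-, ⟨v₁, hv₁, hv₁b, hbv₁⟩, -⟩ := Finset.mem_filter.1 hb
    obtain ⟨h₁, h₂, h₃, h₄, h₅, h₆⟩ := h
    exact havoid u₁ hu₁ u₃ hu₃ v₁ hv₁ v₃ hv₃ m (hsub hm)
      (by constructor <;> lia)
  calc #G ≤ _ := Finset.card_le_card hcover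
    _ ≤ (#rightmost + #highest) + #rest :=
      (Finset.card_union_le _ _).trans (Nat.add_le_add_right (Finset.card_union_le _ _) _)
    _ ≤ (n + n) + n * (2 + 2 * L) := by gcongr
    _ = n * (4 + 2 * L) := by ring

/-- Within a class of points whose coordinates have fixed parities, distinct coordinates differ by
at least two. -/
lemma card_le_of_forall_not_isWalledIn_add_two (G : Finset (ℤ × ℤ)) (n L : ℕ)
    (hcol : #(G.image Prod.fst) ≤ n) (hrow : #(G.image Prod.snd) ≤ n)
    (hrange : ∀ a ∈ G, ∀ b ∈ G, a.2 - b.2 < 2 ^ L)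
    (havoid : ∀ u₁ ∈ G, ∀ u₃ ∈ G, ∀ v₁ ∈ G, ∀ v₃ ∈ G, ∀ w ∈ G,
      ¬IsWalledIn (fun i j => i + 2 ≤ j) u₁ u₃ v₁ v₃ w) :
    #G ≤ 4 * (n * (4 + 2 * L)) := by
  classical
  set parity : ℤ × ℤ → ZMod 2 × ZMod 2 := fun a => (a.1, a.2)
  have gap {i j : ℤ} (hij : (i : ZMod 2) = j) (hlt : i < j) : i + 2 ≤ j := by
    rw [ZMod.intCast_eq_intCast_iff, Int.ModEq] at hij
    lia
  have hclass : ∀ e ∈ (Finset.univ : Finset (ZMod 2 × ZMod 2)),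
      #(G.filter fun a => parity a = e) ≤ n * (4 + 2 * L) := by
    intro e _
    have hsub : (G.filter fun a => parity a = e) ⊆ G := Finset.filter_subset _ _
    have hfst : ∀ a ∈ G.filter (parity · = e), (a.1 : ZMod 2) = e.1 := fun a ha =>
      congr_arg Prod.fst (Finset.mem_filter.1 ha).2
    have hsnd : ∀ a ∈ G.filter (parity · = e), (a.2 : ZMod 2) = e.2 := fun a ha =>
      congr_arg Prod.snd (Finset.mem_filter.1 ha).2
    refine card_le_of_forall_not_isWalledIn _ n L
      ((Finset.card_le_card (Finset.image_subset_image hsub)).trans hcol)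
      ((Finset.card_le_card (Finset.image_subset_image hsub)).trans hrow)
      (fun a ha b hb => hrange a (hsub ha) b (hsub hb))
      fun u₁ hu₁ u₃ hu₃ v₁ hv₁ v₃ hv₃ w hw h => ?_
    exact havoid u₁ (hsub hu₁) u₃ (hsub hu₃) v₁ (hsub hv₁) v₃ (hsub hv₃) w (hsub hw)
      { left := gap ((hfst _ hu₁).trans (hfst _ hw).symm) h.left
        right := gap ((hfst _ hw).trans (hfst _ hu₃).symm) h.right
        bot := gap ((hsnd _ hv₁).trans (hsnd _ hw).symm) h.bot
        top := gap ((hsnd _ hw).trans (hsnd _ hv₃).symm) h.top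
        left_beyond := gap ((hsnd _ hv₃).trans (hsnd _ hu₁).symm) h.left_beyond
        right_beyond := gap ((hsnd _ hv₃).trans (hsnd _ hu₃).symm) h.right_beyond
        bot_beyond := gap ((hfst _ hu₃).trans (hfst _ hv₁).symm) h.bot_beyond
        top_beyond := gap ((hfst _ hu₃).trans (hfst _ hv₃).symm) h.top_beyond }
  calc #G ≤ n * (4 + 2 * L) * #(Finset.univ : Finset (ZMod 2 × ZMod 2)) :=
      Finset.card_le_mul_card_image_of_maps_to (f := parity) (fun _ _ => Finset.mem_univ _) _ hclass
    _ = 4 * (n * (4 + 2 * L)) := by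
      rw [mul_comm]
      rfl

/-! ### Coordinates relative to two points -/

/-- The Euclidean plane. -/
abbrev Plane : Type := EuclideanSpace ℝ (Fin 2)

lemma plane_dist_sq (w w' : Plane) :
    dist w w' ^ 2 = (w 0 - w' 0) ^ 2 + (w 1 - w' 1) ^ 2 := by
  rw [EuclideanSpace.dist_sq_eq, Fin.sum_univ_two, Real.dist_eq, Real.dist_eq, sq_abs, sq_abs]

/-- The coordinate of `w` along the line from `x` to `y`, with origin `x`. -/
noncomputable def along (x y w : Plane) : ℝ :=
  ((y 0 - x 0) * (w 0 - x 0) + (y 1 - x 1) * (w 1 - x 1)) / dist x y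

/-- The signed distance of `w` from the line through `x` and `y`. -/
noncomputable def height (x y w : Plane) : ℝ :=
  ((y 0 - x 0) * (w 1 - x 1) - (y 1 - x 1) * (w 0 - x 0)) / dist x y

@[simp] lemma along_left (x y : Plane) : along x y x = 0 := by simp [along]

@[simp] lemma height_left (x y : Plane) : height x y x = 0 := by simp [height]

@[simp] lemma height_right (x y : Plane) : height x y y = 0 := by
  rw [height, mul_comm, sub_self, zero_div]

@[fun_prop] lemma continuous_along (x y : Plane) : Continuous (along x y) := by
  unfold along
  fun_prop

@[fun_prop] lemma continuous_height (x y : Plane) : Continuous (height x y) := by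
  unfold height
  fun_prop

lemma height_swap (x y w : Plane) : height y x w = -height x y w := by
  rw [height, height, dist_comm y x, ← neg_div]
  ring

lemma along_add_smul_sub (x y a u : Plane) (τ : ℝ) :
    along x y (a + τ • (u - a)) = along x y a + τ * (along x y u - along x y a) := by
  simp only [along, PiLp.add_apply, PiLp.smul_apply, PiLp.sub_apply, smul_eq_mul]
  ring

lemma height_add_smul_sub (x y a u : Plane) (τ : ℝ) :
    height x y (a + τ • (u - a)) = height x y a + τ * (height x y u - height x y a) := by
  simp only [height, PiLp.add_apply, PiLp.smul_apply, PiLp.sub_apply, smul_eq_mul]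
  ring

section Isometry

variable {x y : Plane} (hxy : x ≠ y)
include hxy

lemma along_right : along x y y = dist x y := by
  have hdist := dist_pos.2 hxy
  rw [along, div_eq_iff hdist.ne', ← sq (dist x y), dist_comm, plane_dist_sq]
  ring

lemma along_sub_sq_add_height_sub_sq (w w' : Plane) :
    (along x y w - along x y w') ^ 2 + (height x y w - height x y w') ^ 2 = dist w w' ^ 2 := by
  have hdist : dist x y ≠ 0 := (dist_pos.2 hxy).ne'
  have hsq : dist x y ^ 2 = (y 0 - x 0) ^ 2 + (y 1 - x 1) ^ 2 := by
    rw [dist_comm, plane_dist_sq]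
  have halong : along x y w - along x y w' =
      ((y 0 - x 0) * (w 0 - w' 0) + (y 1 - x 1) * (w 1 - w' 1)) / dist x y := by
    rw [along, along, ← sub_div]
    ring
  have hheight : height x y w - height x y w' =
      ((y 0 - x 0) * (w 1 - w' 1) - (y 1 - x 1) * (w 0 - w' 0)) / dist x y := by
    rw [height, height, ← sub_div]
    ring
  rw [halong, hheight, div_pow, div_pow, ← add_div, div_eq_iff (pow_ne_zero 2 hdist),
    plane_dist_sq, hsq]
  ring

lemma abs_along_sub_le (w w' : Plane) : |along x y w - along x y w'| ≤ dist w w' :=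
  abs_le_of_sq_le_sq (along_sub_sq_add_height_sub_sq hxy w w' ▸
    le_add_of_nonneg_right (sq_nonneg _)) dist_nonneg

lemma abs_height_sub_le (w w' : Plane) : |height x y w - height x y w'| ≤ dist w w' :=
  abs_le_of_sq_le_sq (along_sub_sq_add_height_sub_sq hxy w w' ▸
    le_add_of_nonneg_left (sq_nonneg _)) dist_nonneg

lemma dist_le_along_add_height (w w' : Plane) :
    dist w w' ≤ |along x y w - along x y w'| + |height x y w - height x y w'| := by
  refine le_of_sq_le_sq ?_ (by positivity)
  rw [← along_sub_sq_add_height_sub_sq hxy, add_sq, sq_abs, sq_abs]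
  have : 0 ≤ 2 * |along x y w - along x y w'| * |height x y w - height x y w'| := by positivity
  linarith

end Isometry

/-! ### Visible points and connectedness -/

lemma eq_of_mem_visiblePart {K : Set Plane} {a u w : Plane} (hu : u ∈ visiblePart K a)
    (hw : w ∈ K) (hseg : w ∈ segment ℝ a u) : w = u := by
  have hmem : w ∈ segment ℝ a u ∩ K := ⟨hseg, hw⟩
  rwa [hu.2] at hmem

lemma height_le_of_mem_visiblePart {K : Set Plane} {x y a u w : Plane} (hxy : x ≠ y)
    (ha : height x y a = 0) (hu : u ∈ visiblePart K a) (hhu : 0 < height x y u)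
    (hw : w ∈ K) (hhw : 0 < height x y w)
    (hray : (along x y w - along x y a) * height x y u =
      (along x y u - along x y a) * height x y w) :
    height x y u ≤ height x y w := by
  by_contra! hlt
  set τ := height x y w / height x y u
  have hτ : a + τ • (u - a) = w := by
    refine dist_le_zero.1 ((dist_le_along_add_height hxy _ _).trans_eq ?_)
    have halong : along x y a + τ * (along x y u - along x y a) = along x y w := by
      simp only [τ]
      field_simp
      linarith
    rw [along_add_smul_sub, height_add_smul_sub, ha, halong]
    simp [τ, hhu.ne']
  have hseg : w ∈ segment ℝ a u := by
    rw [segment_eq_image']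
    exact ⟨τ, ⟨(div_pos hhw hhu).le, (div_le_one hhu).2 hlt.le⟩, hτ⟩
  exact hlt.ne (congr_arg _ (eq_of_mem_visiblePart hu hw hseg))

/-- Minus the cotangents of the angles at `x` and at `y` of the triangle with vertices `x`, `y`
and `w`, oriented so that rays from `x` and from `y` are the level sets of the two components. -/
noncomputable def slopes (x y w : Plane) : ℝ × ℝ :=
  (-along x y w / height x y w, (along x y w - dist x y) / height x y w)

lemma slopes_fst_add_snd (x y w : Plane) :
    (slopes x y w).1 + (slopes x y w).2 = -(dist x y / height x y w) := by
  rw [slopes, ← add_div, ← neg_div]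
  ring

section Slopes

variable {x y : Plane}

lemma slopes_fst_add_snd_neg (hxy : x ≠ y) {w : Plane} (hw : 0 < height x y w) :
    (slopes x y w).1 + (slopes x y w).2 < 0 := by
  rw [slopes_fst_add_snd, neg_lt_zero]
  exact div_pos (dist_pos.2 hxy) hw

lemma height_lt_of_slopes_add_lt (hxy : x ≠ y) {p q : Plane} (hp : 0 < height x y p)
    (hq : 0 < height x y q)
    (hpq : (slopes x y p).1 + (slopes x y p).2 < (slopes x y q).1 + (slopes x y q).2) :
    height x y p < height x y q := by
  rw [slopes_fst_add_snd, slopes_fst_add_snd, neg_lt_neg_iff] at hpq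
  exact (div_lt_div_iff_of_pos_left (dist_pos.2 hxy) hq hp).1 hpq

lemma slopes_mem_Icc_iff {a b : ℝ × ℝ} {w : Plane} (hw : 0 < height x y w) :
    slopes x y w ∈ Set.Icc a b ↔
      (a.1 * height x y w ≤ -along x y w ∧ a.2 * height x y w ≤ along x y w - dist x y) ∧
        -along x y w ≤ b.1 * height x y w ∧ along x y w - dist x y ≤ b.2 * height x y w := by
  simp only [slopes, Set.mem_Icc, Prod.le_def, le_div_iff₀ hw, div_le_iff₀ hw]

/-- The points on the positive side of the line through `x` and `y` whose pair of slopes lies in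
`S`. -/
def slopeRegion (x y : Plane) (S : Set (ℝ × ℝ)) : Set Plane :=
  {w | 0 < height x y w} ∩ slopes x y ⁻¹' S

lemma isOpen_slopeRegion {S : Set (ℝ × ℝ)} (hS : IsOpen S) : IsOpen (slopeRegion x y S) := by
  refine ContinuousOn.isOpen_inter_preimage ?_ (isOpen_lt (by fun_prop) (by fun_prop)) hS
  have hne : ∀ w ∈ {w | 0 < height x y w}, height x y w ≠ 0 := fun w hw => ne_of_gt hw
  unfold slopes
  fun_prop (disch := assumption)

lemma isClosed_slopeRegion_Icc (hxy : x ≠ y) {a b : ℝ × ℝ} (hab : a.1 + a.2 < 0) :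
    IsClosed (slopeRegion x y (Set.Icc a b)) := by
  have hset : slopeRegion x y (Set.Icc a b) = {w |
      (a.1 * height x y w ≤ -along x y w ∧ a.2 * height x y w ≤ along x y w - dist x y) ∧
        -along x y w ≤ b.1 * height x y w ∧ along x y w - dist x y ≤ b.2 * height x y w} := by
    ext w
    refine ⟨fun ⟨hw, h⟩ => (slopes_mem_Icc_iff hw).1 h, fun h => ?_⟩
    have hw : 0 < height x y w := by
      have := dist_pos.2 hxy
      obtain ⟨⟨h₁, h₂⟩, -⟩ := h
      by_contra! hcon
      nlinarith [mul_nonneg_of_nonpos_of_nonpos hab.le hcon]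
    exact ⟨hw, (slopes_mem_Icc_iff hw).2 h⟩
  rw [hset]
  simp only [Set.ofPred_and]
  refine ((isClosed_le ?_ ?_).inter (isClosed_le ?_ ?_)).inter
    ((isClosed_le ?_ ?_).inter (isClosed_le ?_ ?_)) <;> fun_prop

lemma slopes_fst_ne_of_mem_visiblePart {K : Set Plane} (hxy : x ≠ y) {u p : Plane}
    (hu : u ∈ visiblePart K x) (hhu : 0 < height x y u) (hp : p ∈ K) (hhp : 0 < height x y p)
    (hlt : (slopes x y p).2 < (slopes x y u).2) : (slopes x y p).1 ≠ (slopes x y u).1 := by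
  intro heq
  refine (height_lt_of_slopes_add_lt hxy hhp hhu (by rw [heq]; gcongr)).not_ge
    (height_le_of_mem_visiblePart hxy (height_left x y) hu hhu hp hhp ?_)
  rw [slopes, slopes, div_eq_div_iff hhp.ne' hhu.ne'] at heq
  rw [along_left]
  linarith

lemma slopes_snd_ne_of_mem_visiblePart {K : Set Plane} (hxy : x ≠ y) {v p : Plane}
    (hv : v ∈ visiblePart K y) (hhv : 0 < height x y v) (hp : p ∈ K) (hhp : 0 < height x y p)
    (hlt : (slopes x y p).1 < (slopes x y v).1) : (slopes x y p).2 ≠ (slopes x y v).2 := by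
  intro heq
  refine (height_lt_of_slopes_add_lt hxy hhp hhv (by rw [heq]; gcongr)).not_ge
    (height_le_of_mem_visiblePart hxy (height_right x y) hv hhv hp hhp ?_)
  rw [slopes, slopes, div_eq_div_iff hhp.ne' hhv.ne'] at heq
  rwa [along_right hxy]

/-- The sight lines to `u₁`, `u₃`, `v₁` and `v₃` bound a box whose boundary `K` cannot cross,
while `u₁` is a point of `K` outside the box. -/
lemma notMem_of_isWalledIn_slopes {K : Set Plane} (hK : IsPreconnected K) (hxy : x ≠ y)
    {u₁ u₃ v₁ v₃ w : Plane} (hu₁ : u₁ ∈ visiblePart K x) (hu₃ : u₃ ∈ visiblePart K x)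
    (hv₁ : v₁ ∈ visiblePart K y) (hv₃ : v₃ ∈ visiblePart K y) (hhu₁ : 0 < height x y u₁)
    (hhu₃ : 0 < height x y u₃) (hhv₁ : 0 < height x y v₁) (hhv₃ : 0 < height x y v₃)
    (hhw : 0 < height x y w)
    (hbox : IsWalledIn (· < ·) (slopes x y u₁) (slopes x y u₃) (slopes x y v₁) (slopes x y v₃)
      (slopes x y w)) : w ∉ K := by
  intro hwK
  set a : ℝ × ℝ := ((slopes x y u₁).1, (slopes x y v₁).2)
  set b : ℝ × ℝ := ((slopes x y u₃).1, (slopes x y v₃).2)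
  set openBox : Set (ℝ × ℝ) := Set.Ioo a.1 b.1 ×ˢ Set.Ioo a.2 b.2
  have hneg : a.1 + a.2 < 0 := lt_trans
    (by have := hbox.bot.trans (hbox.top.trans hbox.left_beyond); simpa [a] using this)
    (slopes_fst_add_snd_neg hxy hhu₁)
  have hcover : K ⊆ slopeRegion x y openBox ∪ (slopeRegion x y (Set.Icc a b))ᶜ := by
    intro p hp
    by_cases hpbox : p ∈ slopeRegion x y (Set.Icc a b)
    swap
    · exact Or.inr hpbox
    obtain ⟨hhp, ⟨hap₁, hap₂⟩, hbp₁, hbp₂⟩ := hpbox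
    have hu₁p := slopes_fst_ne_of_mem_visiblePart hxy hu₁ hhu₁ hp hhp
      (hbp₂.trans_lt hbox.left_beyond)
    have hu₃p := slopes_fst_ne_of_mem_visiblePart hxy hu₃ hhu₃ hp hhp
      (hbp₂.trans_lt hbox.right_beyond)
    have hv₁p := slopes_snd_ne_of_mem_visiblePart hxy hv₁ hhv₁ hp hhp
      (hbp₁.trans_lt hbox.bot_beyond)
    have hv₃p := slopes_snd_ne_of_mem_visiblePart hxy hv₃ hhv₃ hp hhp
      (hbp₁.trans_lt hbox.top_beyond)
    exact Or.inl ⟨hhp, ⟨lt_of_le_of_ne hap₁ hu₁p.symm, lt_of_le_of_ne hbp₁ hu₃p⟩,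
      lt_of_le_of_ne hap₂ hv₁p.symm, lt_of_le_of_ne hbp₂ hv₃p⟩
  have hw : w ∈ slopeRegion x y openBox := ⟨hhw, ⟨hbox.left, hbox.right⟩, hbox.bot, hbox.top⟩
  have hu₁box : u₁ ∉ slopeRegion x y (Set.Icc a b) := fun h => h.2.2.2.not_gt hbox.left_beyond
  obtain ⟨p, -, ⟨hhp, hp₁, hp₂⟩, hpbox⟩ := hK _ _
    (isOpen_slopeRegion (isOpen_Ioo.prod isOpen_Ioo))
    (isClosed_slopeRegion_Icc hxy hneg).isOpen_compl hcover ⟨w, hwK, hw⟩ ⟨u₁, hu₁.1, hu₁box⟩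
  exact hpbox ⟨hhp, ⟨hp₁.1.le, hp₂.1.le⟩, hp₁.2.le, hp₂.2.le⟩

end Slopes

/-! ### The dyadic grid -/

/-- The index of the half-open dyadic square of side `2⁻ᵏ` containing `w`. -/
noncomputable def gridIndex (k : ℕ) (w : Plane) : ℤ × ℤ := (⌊2 ^ k * w 0⌋, ⌊2 ^ k * w 1⌋)

lemma dist_le_of_gridIndex_eq {k : ℕ} {w w' : Plane} (h : gridIndex k w = gridIndex k w') :
    dist w w' ≤ 2 / 2 ^ k := by
  have hk : (0 : ℝ) < 2 ^ k := by positivity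
  have h₀ := (Int.abs_sub_lt_one_of_floor_eq_floor (congr_arg Prod.fst h)).le
  have h₁ := (Int.abs_sub_lt_one_of_floor_eq_floor (congr_arg Prod.snd h)).le
  rw [← mul_sub, ← sq_le_one_iff_abs_le_one, mul_pow] at h₀ h₁
  rw [le_div_iff₀' hk]
  refine le_of_sq_le_sq ?_ zero_le_two
  rw [mul_pow, plane_dist_sq]
  linarith

lemma abs_floor_sub_floor_le {a b : ℝ} {r : ℤ} (h : |a - b| ≤ r) : |⌊a⌋ - ⌊b⌋| ≤ r := by
  obtain ⟨hl, hr⟩ := abs_le.1 h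
  have hba : ⌊b⌋ ≤ ⌊a⌋ + r := by
    rw [← Int.floor_add_intCast]
    exact Int.floor_le_floor (by linarith)
  have hab : ⌊a⌋ ≤ ⌊b⌋ + r := by
    rw [← Int.floor_add_intCast]
    exact Int.floor_le_floor (by linarith)
  rw [abs_le]
  constructor <;> linarith

/-- The square block of lattice points of radius `r` around `z`. -/
noncomputable def latticeBlock (z : ℤ × ℤ) (r : ℕ) : Finset (ℤ × ℤ) :=
  Finset.Icc (z.1 - r) (z.1 + r) ×ˢ Finset.Icc (z.2 - r) (z.2 + r)

lemma card_latticeBlock (z : ℤ × ℤ) (r : ℕ) : #(latticeBlock z r) = (2 * r + 1) ^ 2 := by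
  have hside : ∀ c : ℤ, (c + r + 1 - (c - r)).toNat = 2 * r + 1 := fun c => by lia
  rw [latticeBlock, Finset.card_product, Int.card_Icc, Int.card_Icc, hside, hside, sq]

lemma gridIndex_mem_latticeBlock {k : ℕ} {w w' : Plane} {r : ℕ} (h : dist w' w ≤ r / 2 ^ k) :
    gridIndex k w' ∈ latticeBlock (gridIndex k w) r := by
  have hk : (0 : ℝ) < 2 ^ k := by positivity
  have hcoord : ∀ i : Fin 2, |⌊2 ^ k * w' i⌋ - ⌊2 ^ k * w i⌋| ≤ (r : ℤ) := by
    intro i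
    refine abs_floor_sub_floor_le ?_
    rw [← mul_sub, abs_mul, abs_of_pos hk, Int.cast_natCast, ← le_div_iff₀' hk, ← Real.dist_eq]
    exact (PiLp.dist_apply_le w' w i).trans h
  have h₀ := abs_le.1 (hcoord 0)
  have h₁ := abs_le.1 (hcoord 1)
  simp only [gridIndex, latticeBlock, Finset.mem_product, Finset.mem_Icc]
  constructor <;> constructor <;> linarith

lemma card_le_of_pairwise_dist_le {k : ℕ} (Z : Finset (ℤ × ℤ)) (u : ℤ × ℤ → Plane) (r : ℕ)
    (hu : ∀ z ∈ Z, gridIndex k (u z) = z)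
    (hdist : ∀ z ∈ Z, ∀ z' ∈ Z, dist (u z) (u z') ≤ r / 2 ^ k) : #Z ≤ (2 * r + 1) ^ 2 := by
  rcases Z.eq_empty_or_nonempty with rfl | ⟨z, hz⟩
  · simp
  rw [← card_latticeBlock z r]
  refine Finset.card_le_card fun z' hz' => ?_
  have := gridIndex_mem_latticeBlock (hdist z' hz' z hz)
  rwa [hu z hz, hu z' hz'] at this

lemma gridIndex_eq_of_le {k l : ℕ} (hkl : k ≤ l) {w w' : Plane}
    (h : gridIndex l w = gridIndex l w') : gridIndex k w = gridIndex k w' := by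
  obtain ⟨j, rfl⟩ := Nat.exists_eq_add_of_le hkl
  have hcoarse : ∀ (w : Plane) (i : Fin 2), ⌊2 ^ k * w i⌋ = ⌊2 ^ (k + j) * w i⌋ / (2 ^ j : ℕ) := by
    intro w i
    rw [← Int.floor_div_natCast, pow_add]
    congr 1
    field_simp
    push_cast
    ring
  simp only [gridIndex, Prod.mk.injEq] at h ⊢
  rw [hcoarse, hcoarse w, hcoarse w', hcoarse w', h.1, h.2]
  exact ⟨rfl, rfl⟩

lemma card_image_floor_le {α : Type*} (S : Finset α) (f : α → ℝ) {c : ℝ} (hc : 0 ≤ c)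
    (hf : ∀ a ∈ S, ∀ b ∈ S, |f a - f b| ≤ c) :
    (#(S.image fun a => ⌊f a⌋) : ℝ) ≤ c + 2 := by
  rcases S.eq_empty_or_nonempty with rfl | hne
  · simp only [Finset.image_empty, Finset.card_empty, Nat.cast_zero]
    linarith
  obtain ⟨a, ha, hmin⟩ := S.exists_min_image f hne
  have hsub : (S.image fun a => ⌊f a⌋) ⊆ Finset.Icc ⌊f a⌋ ⌊f a + c⌋ := by
    intro i hi
    obtain ⟨b, hb, rfl⟩ := Finset.mem_image.1 hi
    have := (abs_le.1 (hf b hb a ha)).2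
    exact Finset.mem_Icc.2 ⟨Int.floor_le_floor (hmin b hb), Int.floor_le_floor (by linarith)⟩
  have hle : ⌊f a⌋ ≤ ⌊f a + c⌋ := Int.floor_le_floor (by linarith)
  calc (#(S.image fun a => ⌊f a⌋) : ℝ) ≤ (#(Finset.Icc ⌊f a⌋ ⌊f a + c⌋) : ℤ) := by
        exact_mod_cast Finset.card_le_card hsub
    _ = ⌊f a + c⌋ + 1 - ⌊f a⌋ := by
      rw [Int.card_Icc, Int.toNat_of_nonneg (by lia)]
      push_cast
      ring
    _ ≤ c + 2 := by linarith [Int.floor_le (f a + c), Int.lt_floor_add_one (f a)]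

lemma card_le_mul_of_forall_fiber_le {α β : Type*} [DecidableEq β] (S : Finset α) (f : α → β)
    {b c : ℝ} (hb : 0 ≤ b) (hfiber : ∀ i, (#(S.filter fun a => f a = i) : ℝ) ≤ b)
    (himage : (#(S.image f) : ℝ) ≤ c) : (#S : ℝ) ≤ c * b := by
  rw [Finset.card_eq_sum_card_image f S, Nat.cast_sum]
  calc ∑ i ∈ S.image f, (#(S.filter fun a => f a = i) : ℝ)
      ≤ #(S.image f) • b := Finset.sum_le_card_nsmul _ _ _ fun i _ => hfiber i
    _ = #(S.image f) * b := nsmul_eq_mul _ _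
    _ ≤ c * b := mul_le_mul_of_nonneg_right himage hb

lemma card_le_of_abs_height_sub_le {x y : Plane} (hxy : x ≠ y) {k : ℕ} (Z : Finset (ℤ × ℤ))
    (u : ℤ × ℤ → Plane) (hu : ∀ z ∈ Z, gridIndex k (u z) = z) {c₁ c₂ : ℝ} (hc₁ : 0 ≤ c₁)
    (hc₂ : 0 ≤ c₂)
    (hheight : ∀ z ∈ Z, ∀ z' ∈ Z, |2 ^ k * height x y (u z) - 2 ^ k * height x y (u z')| ≤ c₁)
    (halong : ∀ z ∈ Z, ∀ z' ∈ Z, |height x y (u z) - height x y (u z')| ≤ 1 / 2 ^ k →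
      |2 ^ k * along x y (u z) - 2 ^ k * along x y (u z')| ≤ c₂) :
    (#Z : ℝ) ≤ (c₁ + 2) * ((c₂ + 2) * 25) := by
  have hk : (0 : ℝ) < 2 ^ k := by positivity
  have hfloor {a b : ℝ} (h : ⌊2 ^ k * a⌋ = ⌊2 ^ k * b⌋) : |a - b| ≤ 1 / 2 ^ k := by
    have := (Int.abs_sub_lt_one_of_floor_eq_floor h).le
    rwa [← mul_sub, abs_mul, abs_of_pos hk, ← le_div_iff₀' hk] at this
  refine card_le_mul_of_forall_fiber_le Z (fun z => ⌊2 ^ k * height x y (u z)⌋) (by positivity)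
    (fun i => ?_) (card_image_floor_le Z _ hc₁ hheight)
  set F := Z.filter fun z => ⌊2 ^ k * height x y (u z)⌋ = i
  have hFZ : F ⊆ Z := Finset.filter_subset _ _
  have hF : ∀ z ∈ F, ∀ z' ∈ F, |height x y (u z) - height x y (u z')| ≤ 1 / 2 ^ k :=
    fun z hz z' hz' => hfloor ((Finset.mem_filter.1 hz).2.trans (Finset.mem_filter.1 hz').2.symm)
  refine card_le_mul_of_forall_fiber_le F (fun z => ⌊2 ^ k * along x y (u z)⌋) (by positivity)
    (fun j => ?_) (card_image_floor_le F _ hc₂ fun z hz z' hz' =>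
      halong z (hFZ hz) z' (hFZ hz') (hF z hz z' hz'))
  have hcell := card_le_of_pairwise_dist_le (k := k)
    (F.filter fun z => ⌊2 ^ k * along x y (u z)⌋ = j) u 2
    (fun z hz => hu z (hFZ (Finset.mem_filter.1 hz).1)) fun z hz z' hz' => by
      obtain ⟨hzF, hz⟩ := Finset.mem_filter.1 hz
      obtain ⟨hzF', hz'⟩ := Finset.mem_filter.1 hz'
      calc dist (u z) (u z') ≤ _ := dist_le_along_add_height hxy _ _
        _ ≤ 1 / 2 ^ k + 1 / 2 ^ k :=
          add_le_add (hfloor (hz.trans hz'.symm)) (hF z hzF z' hzF')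
        _ = (2 : ℕ) / 2 ^ k := by
          push_cast
          ring
  exact_mod_cast hcell

/-! ### Dyadic squares meeting two visible parts -/

/-- A choice, in each dyadic square of side `2⁻ᵏ` with index in `Z`, of points `u` and `v` visible
from `x` and from `y` and within distance `R` of these. -/
structure IsMarking (K : Set Plane) (x y : Plane) (R : ℝ) (k : ℕ) (Z : Finset (ℤ × ℤ))
    (u v : ℤ × ℤ → Plane) : Prop where
  gridIndex_left : ∀ z ∈ Z, gridIndex k (u z) = z
  gridIndex_right : ∀ z ∈ Z, gridIndex k (v z) = z
  mem_left : ∀ z ∈ Z, u z ∈ visiblePart K x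
  mem_right : ∀ z ∈ Z, v z ∈ visiblePart K y
  dist_left : ∀ z ∈ Z, dist (u z) x ≤ R
  dist_right : ∀ z ∈ Z, dist (v z) y ≤ R

/-- A marking whose points lie on the positive side of the line through `x` and `y`, at heights
comparable to `H`. -/
structure IsSlabMarking (K : Set Plane) (x y : Plane) (R H : ℝ) (k : ℕ) (Z : Finset (ℤ × ℤ))
    (u v : ℤ × ℤ → Plane) : Prop extends IsMarking K x y R k Z u v where
  eight_le : 8 ≤ H * 2 ^ k
  le_radius : H ≤ R
  le_height_left : ∀ z ∈ Z, H ≤ height x y (u z)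
  height_left_le : ∀ z ∈ Z, height x y (u z) ≤ 4 * H
  le_height_right : ∀ z ∈ Z, H ≤ height x y (v z)

namespace IsMarking

variable {K : Set Plane} {x y : Plane} {R : ℝ} {k : ℕ} {Z : Finset (ℤ × ℤ)} {u v : ℤ × ℤ → Plane}

lemma subset (h : IsMarking K x y R k Z u v) {Z' : Finset (ℤ × ℤ)} (hZ : Z' ⊆ Z) :
    IsMarking K x y R k Z' u v where
  gridIndex_left z hz := h.gridIndex_left z (hZ hz)
  gridIndex_right z hz := h.gridIndex_right z (hZ hz)
  mem_left z hz := h.mem_left z (hZ hz)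
  mem_right z hz := h.mem_right z (hZ hz)
  dist_left z hz := h.dist_left z (hZ hz)
  dist_right z hz := h.dist_right z (hZ hz)

lemma symm (h : IsMarking K x y R k Z u v) : IsMarking K y x R k Z v u where
  gridIndex_left := h.gridIndex_right
  gridIndex_right := h.gridIndex_left
  mem_left := h.mem_right
  mem_right := h.mem_left
  dist_left := h.dist_right
  dist_right := h.dist_left

lemma dist_le (h : IsMarking K x y R k Z u v) {z : ℤ × ℤ} (hz : z ∈ Z) :
    dist (u z) (v z) ≤ 2 / 2 ^ k :=
  dist_le_of_gridIndex_eq ((h.gridIndex_left z hz).trans (h.gridIndex_right z hz).symm)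

lemma abs_along_left_le (h : IsMarking K x y R k Z u v) (hxy : x ≠ y) {z : ℤ × ℤ} (hz : z ∈ Z) :
    |along x y (u z)| ≤ R := by
  have := abs_along_sub_le hxy (u z) x
  rw [along_left, sub_zero] at this
  exact this.trans (h.dist_left z hz)

lemma abs_along_right_sub_le (h : IsMarking K x y R k Z u v) (hxy : x ≠ y) {z : ℤ × ℤ}
    (hz : z ∈ Z) : |along x y (v z) - dist x y| ≤ R := by
  have := abs_along_sub_le hxy (v z) y
  rw [along_right hxy] at this
  exact this.trans (h.dist_right z hz)

end IsMarking

lemma abs_div_sub_div_le {p p' h h' H R e : ℝ} (hH : 0 < H) (hHR : H ≤ R) (hh : H ≤ h)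
    (hh' : H ≤ h') (hp' : |p'| ≤ R) (hpe : |p - p'| ≤ e) (hhe : |h - h'| ≤ e) :
    |p / h - p' / h'| ≤ 2 * R * e / H ^ 2 := by
  have he : 0 ≤ e := (abs_nonneg _).trans hpe
  have hR : 0 < R := hH.trans_le hHR
  have hpos : 0 < h := hH.trans_le hh
  have hpos' : 0 < h' := hH.trans_le hh'
  calc |p / h - p' / h'| = |(p - p') / h - p' * (h - h') / (h * h')| := by
        congr 1
        field_simp
        ring
    _ ≤ |(p - p') / h| + |p' * (h - h') / (h * h')| := abs_sub _ _
    _ = |p - p'| / h + |p'| * |h - h'| / (h * h') := by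
      rw [abs_div, abs_div, abs_mul, abs_of_pos hpos, abs_of_pos (mul_pos hpos hpos')]
    _ ≤ e / H + R * e / (H * H) := by gcongr
    _ ≤ R / H * (e / H) + R * e / (H * H) := by
      gcongr
      exact le_mul_of_one_le_left (by positivity) ((one_le_div hH).2 hHR)
    _ = 2 * R * e / H ^ 2 := by
      field_simp
      ring

lemma lt_sub_of_floor_div_add_two_le {W a b : ℝ} (hW : 0 < W) (h : ⌊a / W⌋ + 2 ≤ ⌊b / W⌋) :
    W < b - a := by
  have hfloor : (⌊a / W⌋ : ℝ) + 2 ≤ ⌊b / W⌋ := by exact_mod_cast h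
  have hlt : 1 < b / W - a / W := by linarith [Int.floor_le (b / W), Int.lt_floor_add_one (a / W)]
  rwa [← sub_div, one_lt_div hW] at hlt

lemma abs_sub_le_of_floor_div_eq {W a b : ℝ} (hW : 0 < W) (h : ⌊a / W⌋ = ⌊b / W⌋) :
    |a - b| ≤ W := by
  have := Int.abs_sub_lt_one_of_floor_eq_floor h
  rw [← sub_div, abs_div, abs_of_pos hW, div_lt_one hW] at this
  exact this.le

/-- The width of the slope cells: points of one dyadic square of side `2⁻ᵏ`, at height at least `H`
and within distance `R`, have slopes differing by at most this much. -/
noncomputable def slopeWidth (R H : ℝ) (k : ℕ) : ℝ := 4 * R / (2 ^ k * H ^ 2)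

/-- The cell of a marked square in the grid of slopes, for which the slope at `x` of the point
visible from `x` and the slope at `y` of the point visible from `y` are used. -/
noncomputable def slopeCell (x y : Plane) (W : ℝ) (u v : ℤ × ℤ → Plane) (z : ℤ × ℤ) : ℤ × ℤ :=
  (⌊(slopes x y (u z)).1 / W⌋, ⌊(slopes x y (v z)).2 / W⌋)

namespace IsSlabMarking

variable {K : Set Plane} {x y : Plane} {R H : ℝ} {k : ℕ} {Z : Finset (ℤ × ℤ)}
  {u v : ℤ × ℤ → Plane}

lemma height_pos (h : IsSlabMarking K x y R H k Z u v) : 0 < H :=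
  pos_of_mul_pos_left (lt_of_lt_of_le (by norm_num) h.eight_le) (by positivity)

lemma slopeWidth_pos (h : IsSlabMarking K x y R H k Z u v) : 0 < slopeWidth R H k := by
  have := h.height_pos
  have := this.trans_le h.le_radius
  unfold slopeWidth
  positivity

lemma slopeWidth_eq (R H : ℝ) (k : ℕ) : 2 * R * (2 / 2 ^ k) / H ^ 2 = slopeWidth R H k := by
  rw [slopeWidth]
  ring

variable (h : IsSlabMarking K x y R H k Z u v) (hxy : x ≠ y)
include h hxy

lemma abs_slopes_fst_sub_le {z : ℤ × ℤ} (hz : z ∈ Z) :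
    |(slopes x y (u z)).1 - (slopes x y (v z)).1| ≤ slopeWidth R H k := by
  rw [← slopeWidth_eq, abs_sub_comm]
  refine abs_div_sub_div_le h.height_pos h.le_radius (h.le_height_right z hz)
    (h.le_height_left z hz) ?_ ?_ ?_
  · rw [abs_neg]
    exact h.abs_along_left_le hxy hz
  · rw [neg_sub_neg]
    exact (abs_along_sub_le hxy _ _).trans (h.dist_le hz)
  · rw [abs_sub_comm]
    exact (abs_height_sub_le hxy _ _).trans (h.dist_le hz)

lemma abs_slopes_snd_sub_le {z : ℤ × ℤ} (hz : z ∈ Z) :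
    |(slopes x y (u z)).2 - (slopes x y (v z)).2| ≤ slopeWidth R H k := by
  rw [← slopeWidth_eq]
  refine abs_div_sub_div_le h.height_pos h.le_radius (h.le_height_left z hz)
    (h.le_height_right z hz) (h.abs_along_right_sub_le hxy hz) ?_ ?_
  · rw [sub_sub_sub_cancel_right]
    exact (abs_along_sub_le hxy _ _).trans (h.dist_le hz)
  · exact (abs_height_sub_le hxy _ _).trans (h.dist_le hz)

lemma abs_slopes_fst_le {z : ℤ × ℤ} (hz : z ∈ Z) : |(slopes x y (u z)).1| ≤ R / H := by
  have hpos := h.height_pos.trans_le (h.le_height_left z hz)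
  rw [slopes, abs_div, abs_neg, abs_of_pos hpos]
  exact div_le_div₀ (h.height_pos.le.trans h.le_radius) (h.abs_along_left_le hxy hz) h.height_pos
    (h.le_height_left z hz)

lemma abs_slopes_snd_le {z : ℤ × ℤ} (hz : z ∈ Z) : |(slopes x y (v z)).2| ≤ R / H := by
  have hpos := h.height_pos.trans_le (h.le_height_right z hz)
  rw [slopes, abs_div, abs_of_pos hpos]
  exact div_le_div₀ (h.height_pos.le.trans h.le_radius) (h.abs_along_right_sub_le hxy hz)
    h.height_pos (h.le_height_right z hz)

omit hxy in
lemma abs_div_slopeWidth_sub_le {a b : ℝ} (ha : |a| ≤ R / H) (hb : |b| ≤ R / H) :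
    |a / slopeWidth R H k - b / slopeWidth R H k| ≤ H * 2 ^ k / 2 := by
  have hH := h.height_pos
  have hR := hH.trans_le h.le_radius
  rw [← sub_div, abs_div, abs_of_pos h.slopeWidth_pos, div_le_iff₀ h.slopeWidth_pos]
  calc |a - b| ≤ R / H + R / H := (abs_sub a b).trans (add_le_add ha hb)
    _ = H * 2 ^ k / 2 * slopeWidth R H k := by
      rw [slopeWidth]
      field_simp
      norm_num

lemma not_isWalledIn_slopeCell (hK : IsPreconnected K) {z₁ z₃ z₄ z₅ z₂ : ℤ × ℤ} (hz₁ : z₁ ∈ Z)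
    (hz₃ : z₃ ∈ Z) (hz₄ : z₄ ∈ Z) (hz₅ : z₅ ∈ Z) (hz₂ : z₂ ∈ Z) :
    ¬IsWalledIn (fun i j => i + 2 ≤ j) (slopeCell x y (slopeWidth R H k) u v z₁)
      (slopeCell x y (slopeWidth R H k) u v z₃) (slopeCell x y (slopeWidth R H k) u v z₄)
      (slopeCell x y (slopeWidth R H k) u v z₅) (slopeCell x y (slopeWidth R H k) u v z₂) := by
  intro hbox
  have hW := h.slopeWidth_pos
  have hu₁ := abs_le.1 (h.abs_slopes_snd_sub_le hxy hz₁)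
  have hu₃ := abs_le.1 (h.abs_slopes_snd_sub_le hxy hz₃)
  have hv₄ := abs_le.1 (h.abs_slopes_fst_sub_le hxy hz₄)
  have hv₅ := abs_le.1 (h.abs_slopes_fst_sub_le hxy hz₅)
  have hw := abs_le.1 (h.abs_slopes_snd_sub_le hxy hz₂)
  refine notMem_of_isWalledIn_slopes hK hxy (h.mem_left z₁ hz₁) (h.mem_left z₃ hz₃)
    (h.mem_right z₄ hz₄) (h.mem_right z₅ hz₅) (h.height_pos.trans_le (h.le_height_left z₁ hz₁))
    (h.height_pos.trans_le (h.le_height_left z₃ hz₃))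
    (h.height_pos.trans_le (h.le_height_right z₄ hz₄))
    (h.height_pos.trans_le (h.le_height_right z₅ hz₅))
    (h.height_pos.trans_le (h.le_height_left z₂ hz₂))
    { left := ?_, right := ?_, bot := ?_, top := ?_, left_beyond := ?_, right_beyond := ?_,
      bot_beyond := ?_, top_beyond := ?_ } (h.mem_left z₂ hz₂).1
  · linarith [lt_sub_of_floor_div_add_two_le hW hbox.left]
  · linarith [lt_sub_of_floor_div_add_two_le hW hbox.right]
  · linarith [lt_sub_of_floor_div_add_two_le hW hbox.bot]
  · linarith [lt_sub_of_floor_div_add_two_le hW hbox.top]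
  · linarith [lt_sub_of_floor_div_add_two_le hW hbox.left_beyond]
  · linarith [lt_sub_of_floor_div_add_two_le hW hbox.right_beyond]
  · linarith [lt_sub_of_floor_div_add_two_le hW hbox.bot_beyond]
  · linarith [lt_sub_of_floor_div_add_two_le hW hbox.top_beyond]

lemma card_image_slopeCell_le (hK : IsPreconnected K) {L : ℕ} (hL : R * 2 ^ k ≤ 2 ^ L) :
    (#(Z.image (slopeCell x y (slopeWidth R H k) u v)) : ℝ) ≤
      4 * (H * 2 ^ k * (4 + 2 * L)) := by
  have hH := h.height_pos
  set n := ⌊H * 2 ^ k⌋₊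
  set G := Z.image (slopeCell x y (slopeWidth R H k) u v) with hG
  have hcol : #(G.image Prod.fst) ≤ n := by
    refine Nat.le_floor ?_
    rw [hG, Finset.image_image]
    refine (card_image_floor_le Z _ (by positivity) fun z hz z' hz' =>
      h.abs_div_slopeWidth_sub_le (h.abs_slopes_fst_le hxy hz)
        (h.abs_slopes_fst_le hxy hz')).trans ?_
    linarith [h.eight_le]
  have hrow : #(G.image Prod.snd) ≤ n := by
    refine Nat.le_floor ?_
    rw [hG, Finset.image_image]
    refine (card_image_floor_le Z _ (by positivity) fun z hz z' hz' =>
      h.abs_div_slopeWidth_sub_le (h.abs_slopes_snd_le hxy hz)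
        (h.abs_slopes_snd_le hxy hz')).trans ?_
    linarith [h.eight_le]
  have hrange : ∀ a ∈ G, ∀ b ∈ G, a.2 - b.2 < 2 ^ L := by
    simp only [hG, Finset.forall_mem_image, slopeCell]
    intro z hz z' hz'
    have hsub := (abs_le.1 (h.abs_div_slopeWidth_sub_le (h.abs_slopes_snd_le hxy hz)
      (h.abs_slopes_snd_le hxy hz'))).2
    have hHR : H * 2 ^ k ≤ R * 2 ^ k := by gcongr; exact h.le_radius
    rify
    linarith [Int.floor_le ((slopes x y (v z)).2 / slopeWidth R H k),
      Int.lt_floor_add_one ((slopes x y (v z')).2 / slopeWidth R H k), h.eight_le]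
  have hcard : #G ≤ 4 * (n * (4 + 2 * L)) := by
    refine card_le_of_forall_not_isWalledIn_add_two G n L hcol hrow hrange ?_
    simp only [hG, Finset.forall_mem_image]
    exact fun z₁ hz₁ z₃ hz₃ z₄ hz₄ z₅ hz₅ z₂ hz₂ =>
      h.not_isWalledIn_slopeCell hxy hK hz₁ hz₃ hz₄ hz₅ hz₂
  calc (#G : ℝ) ≤ 4 * (n * (4 + 2 * L)) := by exact_mod_cast hcard
    _ ≤ 4 * (H * 2 ^ k * (4 + 2 * L)) := by
      gcongr
      exact Nat.floor_le (by positivity)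

section SameCell

variable {z z' : ℤ × ℤ} (hz : z ∈ Z) (hz' : z' ∈ Z)
  (hcell : slopeCell x y (slopeWidth R H k) u v z = slopeCell x y (slopeWidth R H k) u v z')
include hz hz' hcell

lemma abs_height_sub_le_of_slopeCell_eq :
    |2 ^ k * height x y (u z) - 2 ^ k * height x y (u z')| ≤ 256 * R / dist x y := by
  have hH := h.height_pos
  have hR := hH.trans_le h.le_radius
  have hρ := dist_pos.2 hxy
  have ha := hH.trans_le (h.le_height_left z hz)
  have hb := hH.trans_le (h.le_height_left z' hz')
  have hinv : |dist x y / height x y (u z) - dist x y / height x y (u z')| ≤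
      4 * slopeWidth R H k := by
    have hfst := abs_le.1 (abs_sub_le_of_floor_div_eq h.slopeWidth_pos (Prod.ext_iff.1 hcell).1)
    have hsnd := abs_le.1 (abs_sub_le_of_floor_div_eq h.slopeWidth_pos (Prod.ext_iff.1 hcell).2)
    have hz := abs_le.1 (h.abs_slopes_snd_sub_le hxy hz)
    have hz' := abs_le.1 (h.abs_slopes_snd_sub_le hxy hz')
    have hsum := slopes_fst_add_snd x y (u z)
    have hsum' := slopes_fst_add_snd x y (u z')
    rw [abs_le]
    constructor <;> linarith
  set a := height x y (u z)
  set b := height x y (u z')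
  calc |2 ^ k * a - 2 ^ k * b|
      = |-(2 ^ k * (a * b) / dist x y * (dist x y / a - dist x y / b))| := by
        congr 1
        field_simp
        ring
    _ = 2 ^ k * (a * b) / dist x y * |dist x y / a - dist x y / b| := by
      rw [abs_neg, abs_mul, abs_of_pos (by positivity)]
    _ ≤ 2 ^ k * ((4 * H) * (4 * H)) / dist x y * (4 * slopeWidth R H k) := by
      gcongr
      · exact h.height_left_le z hz
      · exact h.height_left_le z' hz'
    _ = 256 * R / dist x y := by
      rw [slopeWidth]
      field_simp
      norm_num

lemma abs_along_sub_le_of_slopeCell_eq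
    (hheight : |height x y (u z) - height x y (u z')| ≤ 1 / 2 ^ k) :
    |2 ^ k * along x y (u z) - 2 ^ k * along x y (u z')| ≤ 17 * R / H := by
  have hH := h.height_pos
  have hslope := abs_sub_le_of_floor_div_eq h.slopeWidth_pos (Prod.ext_iff.1 hcell).1
  have hslope' := h.abs_slopes_fst_le hxy hz'
  have ha := hH.trans_le (h.le_height_left z hz)
  have hb := hH.trans_le (h.le_height_left z' hz')
  have halong : along x y (u z) = -((slopes x y (u z)).1 * height x y (u z)) := by
    rw [slopes, div_mul_cancel₀ _ ha.ne', neg_neg]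
  have halong' : along x y (u z') = -((slopes x y (u z')).1 * height x y (u z')) := by
    rw [slopes, div_mul_cancel₀ _ hb.ne', neg_neg]
  rw [halong, halong']
  set a := height x y (u z)
  set b := height x y (u z')
  set p := (slopes x y (u z)).1
  set q := (slopes x y (u z')).1
  have hR := hH.trans_le h.le_radius
  calc |2 ^ k * -(p * a) - 2 ^ k * -(q * b)| = |-(2 ^ k * ((p - q) * a + q * (a - b)))| := by
        congr 1
        ring
    _ = 2 ^ k * |(p - q) * a + q * (a - b)| := by
      rw [abs_neg, abs_mul, abs_of_pos (by positivity)]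
    _ ≤ 2 ^ k * (|p - q| * a + |q| * |a - b|) := by
      gcongr
      refine (abs_add_le _ _).trans_eq ?_
      rw [abs_mul, abs_mul, abs_of_pos ha]
    _ ≤ 2 ^ k * (slopeWidth R H k * (4 * H) + R / H * (1 / 2 ^ k)) := by
      gcongr
      · exact h.slopeWidth_pos.le
      · exact h.height_left_le z hz
    _ = 17 * R / H := by
      rw [slopeWidth]
      field_simp
      norm_num

end SameCell

lemma card_filter_slopeCell_eq_le (hρ : dist x y ≤ R) (c : ℤ × ℤ) :
    (#(Z.filter fun z => slopeCell x y (slopeWidth R H k) u v z = c) : ℝ) ≤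
      258 * R / dist x y * (19 * R / H * 25) := by
  have hH := h.height_pos
  have hR := hH.trans_le h.le_radius
  have hρ₀ := dist_pos.2 hxy
  set F := Z.filter fun z => slopeCell x y (slopeWidth R H k) u v z = c
  have hF : ∀ z ∈ F, z ∈ Z := fun z hz => Finset.mem_of_mem_filter z hz
  have hcell : ∀ z ∈ F, ∀ z' ∈ F, slopeCell x y (slopeWidth R H k) u v z =
      slopeCell x y (slopeWidth R H k) u v z' := fun z hz z' hz' =>
    (Finset.mem_filter.1 hz).2.trans (Finset.mem_filter.1 hz').2.symm
  calc (#F : ℝ) ≤ (256 * R / dist x y + 2) * ((17 * R / H + 2) * 25) := by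
        refine card_le_of_abs_height_sub_le hxy F u (fun z hz => h.gridIndex_left z (hF z hz))
          (by positivity) (by positivity) ?_ ?_
        · exact fun z hz z' hz' => h.abs_height_sub_le_of_slopeCell_eq hxy (hF z hz) (hF z' hz')
            (hcell z hz z' hz')
        · exact fun z hz z' hz' => h.abs_along_sub_le_of_slopeCell_eq hxy (hF z hz) (hF z' hz')
            (hcell z hz z' hz')
    _ ≤ (256 * R / dist x y + 2 * (R / dist x y)) * ((17 * R / H + 2 * (R / H)) * 25) := by
      have hone := (one_le_div hρ₀).2 hρ
      have hone' := (one_le_div hH).2 h.le_radius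
      gcongr <;> linarith
    _ = 258 * R / dist x y * (19 * R / H * 25) := by ring

lemma card_le (hK : IsPreconnected K)
    (hρ : dist x y ≤ R) {L : ℕ} (hL : R * 2 ^ k ≤ 2 ^ L) :
    (#Z : ℝ) ≤ 980400 * (L + 2) * R ^ 2 * 2 ^ k / dist x y := by
  have hH := h.height_pos
  have hR := hH.trans_le h.le_radius
  have hρ₀ := dist_pos.2 hxy
  refine (card_le_mul_of_forall_fiber_le Z _ (by positivity)
    (h.card_filter_slopeCell_eq_le hxy hρ) (h.card_image_slopeCell_le hxy hK hL)).trans_eq ?_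
  field_simp
  ring

end IsSlabMarking

namespace IsMarking

variable {K : Set Plane} {x y : Plane} {R : ℝ} {k : ℕ} {Z : Finset (ℤ × ℤ)} {u v : ℤ × ℤ → Plane}

lemma abs_height_left_le (h : IsMarking K x y R k Z u v) (hxy : x ≠ y) {z : ℤ × ℤ} (hz : z ∈ Z) :
    |height x y (u z)| ≤ R := by
  have := abs_height_sub_le hxy (u z) x
  rw [height_left, sub_zero] at this
  exact this.trans (h.dist_left z hz)

lemma abs_height_sub_height_le (h : IsMarking K x y R k Z u v) (hxy : x ≠ y) {z : ℤ × ℤ}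
    (hz : z ∈ Z) : |height x y (u z) - height x y (v z)| ≤ 2 / 2 ^ k :=
  (abs_height_sub_le hxy _ _).trans (h.dist_le hz)

lemma isSlabMarking (h : IsMarking K x y R k Z u v) (hxy : x ≠ y) {H : ℝ} (hH : 8 ≤ H * 2 ^ k)
    (hHR : H ≤ R) (hlow : ∀ z ∈ Z, 2 * H ≤ height x y (u z))
    (hhigh : ∀ z ∈ Z, height x y (u z) ≤ 4 * H) : IsSlabMarking K x y R H k Z u v where
  toIsMarking := h
  eight_le := hH
  le_radius := hHR
  le_height_left z hz := by
    have : 0 < H := pos_of_mul_pos_left (lt_of_lt_of_le (by norm_num) hH) (by positivity)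
    linarith [hlow z hz]
  height_left_le := hhigh
  le_height_right z hz := by
    have hH' : 8 / 2 ^ k ≤ H := (div_le_iff₀ (by positivity)).2 hH
    have hsub := (abs_le.1 (h.abs_height_sub_height_le hxy hz)).2
    have : (2 : ℝ) / 2 ^ k ≤ 8 / 2 ^ k := by gcongr; norm_num
    linarith [hlow z hz]

lemma card_le_of_le_height (h : IsMarking K x y R k Z u v) (hxy : x ≠ y) (hK : IsPreconnected K)
    (hρ : dist x y ≤ R) {L : ℕ} (hL : R * 2 ^ k ≤ 2 ^ L)
    (hheight : ∀ z ∈ Z, 16 / 2 ^ k ≤ height x y (u z)) :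
    (#Z : ℝ) ≤ L * (980400 * (L + 2) * R ^ 2 * 2 ^ k / dist x y) := by
  have hρ₀ := dist_pos.2 hxy
  have hk : (0 : ℝ) < 2 ^ k := by positivity
  have hlevel (z) (hz : z ∈ Z) : ∃ j < L, 2 ^ j * (16 / 2 ^ k) ≤ height x y (u z) ∧
      height x y (u z) < 2 ^ (j + 1) * (16 / 2 ^ k) := by
    have hpos : (0 : ℝ) < 16 / 2 ^ k := by positivity
    obtain ⟨j, hj, hj'⟩ := exists_nat_pow_near ((one_le_div hpos).2 (hheight z hz)) one_lt_two
    rw [le_div_iff₀ hpos] at hj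
    rw [div_lt_iff₀ hpos] at hj'
    refine ⟨j, (pow_lt_pow_iff_right₀ (one_lt_two (α := ℝ))).1 ?_, hj, hj'⟩
    have hR : 2 ^ j * (16 / 2 ^ k) ≤ R :=
      hj.trans ((le_abs_self _).trans (h.abs_height_left_le hxy hz))
    rw [← mul_div_assoc, div_le_iff₀ hk] at hR
    linarith [pow_pos (two_pos (α := ℝ)) j]
  choose! j hjL hj hj' using hlevel
  refine card_le_mul_of_forall_fiber_le Z j (by positivity) (fun i => ?_) ?_
  · obtain hempty | ⟨z, hz⟩ := (Z.filter fun z => j z = i).eq_empty_or_nonempty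
    · rw [hempty, Finset.card_empty, Nat.cast_zero]
      positivity
    have hmem {z} (hz : z ∈ Z.filter fun z => j z = i) : z ∈ Z ∧ j z = i := Finset.mem_filter.1 hz
    refine ((h.subset (Finset.filter_subset _ Z)).isSlabMarking (H := 2 ^ i * (8 / 2 ^ k)) hxy
      ?_ ?_ ?_ ?_).card_le hxy hK hρ hL
    · rw [mul_assoc, div_mul_cancel₀ _ hk.ne']
      linarith [one_le_pow₀ (one_le_two (α := ℝ)) (n := i)]
    · obtain ⟨hzZ, hzi⟩ := hmem hz
      have hle := (hj z hzZ).trans ((le_abs_self _).trans (h.abs_height_left_le hxy hzZ))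
      rw [hzi] at hle
      refine le_trans ?_ hle
      gcongr
      norm_num
    · intro z hz
      obtain ⟨hzZ, rfl⟩ := hmem hz
      exact le_of_eq_of_le (by ring) (hj z hzZ)
    · intro z hz
      obtain ⟨hzZ, rfl⟩ := hmem hz
      exact (hj' z hzZ).le.trans_eq (by ring)
  · rw [← Finset.card_range L]
    exact_mod_cast Finset.card_le_card (Finset.image_subset_iff.2 fun z hz =>
      Finset.mem_range.2 (hjL z hz))

lemma card_le_of_abs_height_le (h : IsMarking K x y R k Z u v) (hxy : x ≠ y)
    (hR : 1 ≤ R * 2 ^ k) (hheight : ∀ z ∈ Z, |height x y (u z)| ≤ 18 / 2 ^ k) :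
    (#Z : ℝ) ≤ 3800 * (R * 2 ^ k) := by
  have hk : (0 : ℝ) < 2 ^ k := by positivity
  calc (#Z : ℝ) ≤ (36 + 2) * ((2 * (R * 2 ^ k) + 2) * 25) := by
        refine card_le_of_abs_height_sub_le hxy Z u h.gridIndex_left (by norm_num) (by linarith)
          (fun z hz z' hz' => ?_) fun z hz z' hz' _ => ?_
        · rw [← mul_sub, abs_mul, abs_of_pos hk, ← le_div_iff₀' hk]
          exact (abs_sub _ _).trans
            ((add_le_add (hheight z hz) (hheight z' hz')).trans_eq (by ring))
        · rw [← mul_sub, abs_mul, abs_of_pos hk, ← le_div_iff₀' hk, mul_div_assoc,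
            mul_div_cancel_right₀ _ hk.ne', two_mul]
          exact (abs_sub _ _).trans
            (add_le_add (h.abs_along_left_le hxy hz) (h.abs_along_left_le hxy hz'))
    _ ≤ 3800 * (R * 2 ^ k) := by linarith

lemma card_le (h : IsMarking K x y R k Z u v) (hxy : x ≠ y) (hK : IsPreconnected K)
    (hρ : dist x y ≤ R) {L : ℕ} (hL : R * 2 ^ k ≤ 2 ^ L) (hR : 1 ≤ R * 2 ^ k) :
    (#Z : ℝ) ≤ 2000000 * (L + 2) ^ 2 * R ^ 2 * 2 ^ k / dist x y := by
  have hρ₀ := dist_pos.2 hxy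
  set S := 980400 * (L + 2) * R ^ 2 * 2 ^ k / dist x y with hS
  set Zmid := Z.filter fun z => |height x y (u z)| ≤ 18 / 2 ^ k
  set Zup := Z.filter fun z => 16 / 2 ^ k ≤ height x y (u z)
  set Zdown := Z.filter fun z => 16 / 2 ^ k ≤ height y x (v z)
  have hmid : (#Zmid : ℝ) ≤ 3800 * (R * 2 ^ k) :=
    (h.subset (Finset.filter_subset _ Z)).card_le_of_abs_height_le hxy hR fun z hz =>
      (Finset.mem_filter.1 hz).2
  have hup : (#Zup : ℝ) ≤ L * S :=
    (h.subset (Finset.filter_subset _ Z)).card_le_of_le_height hxy hK hρ hL fun z hz =>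
      (Finset.mem_filter.1 hz).2
  have hdown : (#Zdown : ℝ) ≤ L * S := by
    rw [hS, dist_comm x y]
    exact (h.symm.subset (Finset.filter_subset _ Z)).card_le_of_le_height hxy.symm hK
      (dist_comm x y ▸ hρ) hL fun z hz => (Finset.mem_filter.1 hz).2
  have hunion : Z ⊆ Zmid ∪ (Zup ∪ Zdown) := by
    intro z hz
    have hsub := abs_le.1 (h.abs_height_sub_height_le hxy hz)
    have hswap := height_swap x y (v z)
    simp only [Zmid, Zup, Zdown, Finset.mem_union, Finset.mem_filter, hz, true_and]
    by_contra! hnot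
    obtain ⟨hmid, hup, hdown⟩ := hnot
    have h18 : (18 : ℝ) / 2 ^ k = 16 / 2 ^ k + 2 / 2 ^ k := by ring
    have hk : (0 : ℝ) < 2 / 2 ^ k := by positivity
    refine hmid.not_ge (abs_le.2 ⟨?_, ?_⟩) <;> linarith
  have hcard : (#Z : ℝ) ≤ #Zmid + (#Zup + #Zdown) := by
    exact_mod_cast (Finset.card_le_card hunion).trans ((Finset.card_union_le _ _).trans
      (Nat.add_le_add_left (Finset.card_union_le _ _) _))
  have hR' : R * 2 ^ k ≤ R ^ 2 * 2 ^ k / dist x y := by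
    rw [le_div_iff₀ hρ₀]
    nlinarith
  calc (#Z : ℝ) ≤ 3800 * (R ^ 2 * 2 ^ k / dist x y) + (L * S + L * S) := by linarith
    _ = (3800 + 1960800 * (L * (L + 2))) * (R ^ 2 * 2 ^ k / dist x y) := by
      rw [hS]
      ring
    _ ≤ 2000000 * (L + 2) ^ 2 * (R ^ 2 * 2 ^ k / dist x y) := by
      gcongr
      nlinarith [(Nat.cast_nonneg L : (0 : ℝ) ≤ L)]
    _ = 2000000 * (L + 2) ^ 2 * R ^ 2 * 2 ^ k / dist x y := by ring

end IsMarking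

/-! ### Hausdorff measure and covers by dyadic squares -/

section HausdorffMeasure

open MeasureTheory MeasureTheory.Measure

lemma exists_pos_forall_le_tsum_ediam_rpow {X : Type*} [EMetricSpace X] [MeasurableSpace X]
    [BorelSpace X] {A : Set X} {t : ℝ} (ht : 0 < t) (hA : μH[t] A ≠ 0) :
    ∃ c : ENNReal, 0 < c ∧ ∀ (ι : Type) [Countable ι] (U : ι → Set X), A ⊆ ⋃ i, U i →
      c ≤ ∑' i, Metric.ediam (U i) ^ t := by
  by_contra! hcon
  choose ι hι U hU hlt using fun n : ℕ =>
    hcon (n : ENNReal)⁻¹ (ENNReal.inv_pos.2 (ENNReal.natCast_ne_top n))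
  have htend := ENNReal.tendsto_inv_nat_nhds_zero
  have hradius := htend.ennrpow_const t⁻¹
  rw [ENNReal.zero_rpow_of_pos (inv_pos.2 ht)] at hradius
  refine hA (le_antisymm ?_ zero_le)
  calc μH[t] A ≤ Filter.liminf (fun n => ∑' i, Metric.ediam (U n i) ^ t) Filter.atTop :=
        hausdorffMeasure_le_liminf_tsum t A _ hradius U
          (.of_forall fun n i => (ENNReal.le_rpow_inv_iff ht).2
            ((ENNReal.le_tsum i).trans (hlt n).le)) (.of_forall hU)
    _ ≤ Filter.liminf (fun n : ℕ => (n : ENNReal)⁻¹) Filter.atTop :=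
      Filter.liminf_le_liminf (.of_forall fun n => (hlt n).le)
    _ = 0 := htend.liminf_eq

lemma exists_cover_of_hausdorffMeasure_eq_zero {X : Type*} [EMetricSpace X] [MeasurableSpace X]
    [BorelSpace X] {A : Set X} {d : ℝ} (hd : 0 < d) (hA : μH[d] A = 0) {r : ENNReal}
    (hr : 0 < r) :
    ∃ U : ℕ → Set X, A ⊆ ⋃ n, U n ∧ (∀ n, Metric.ediam (U n) ≤ r) ∧
      ∑' n, Metric.ediam (U n) ^ d < 1 := by
  have hlt := (le_iSup₂ r hr).trans_lt
    ((hausdorffMeasure_apply d A).symm.trans hA |>.trans_lt zero_lt_one)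
  simp only [iInf_lt_iff] at hlt
  obtain ⟨U, hU, hdiam, hsum⟩ := hlt
  refine ⟨U, hU, hdiam, (ENNReal.tsum_le_tsum fun n => ?_).trans_lt hsum⟩
  obtain hempty | hne := (U n).eq_empty_or_nonempty
  · rw [hempty, Metric.ediam_empty, ENNReal.zero_rpow_of_pos hd]
    exact zero_le
  · rw [iSup_pos hne]

lemma two_rpow_neg_mul_natCast (t : ℝ) (k : ℕ) : (2 : ℝ) ^ (-(t * k)) = (1 / 2 ^ k) ^ t := by
  rw [Real.div_rpow zero_le_one (by positivity), Real.one_rpow, ← Real.rpow_natCast_mul zero_le_two,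
    Real.rpow_neg zero_le_two, one_div, mul_comm]

lemma summable_two_rpow_neg_mul {t : ℝ} (ht : 0 < t) :
    Summable fun k : ℕ => (2 : ℝ) ^ (-(t * k)) := by
  simp_rw [← neg_mul, Real.rpow_mul_natCast zero_le_two]
  exact summable_geometric_of_lt_one (by positivity)
    (Real.rpow_lt_one_of_one_lt_of_neg one_lt_two (neg_lt_zero.2 ht))

lemma ediam_gridIndex_fiber_rpow_le {t : ℝ} (ht : 0 < t) (k : ℕ) (z : ℤ × ℤ) :
    Metric.ediam {w : Plane | gridIndex k w = z} ^ t ≤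
      ENNReal.ofReal (2 ^ t) * ENNReal.ofReal (2 ^ (-(t * k))) := by
  have hdiam : Metric.ediam {w : Plane | gridIndex k w = z} ≤ ENNReal.ofReal (2 * (1 / 2 ^ k)) := by
    refine Metric.ediam_le fun w hw w' hw' => ?_
    rw [edist_dist, mul_one_div]
    exact ENNReal.ofReal_le_ofReal (dist_le_of_gridIndex_eq (hw.trans hw'.symm))
  refine (ENNReal.rpow_le_rpow hdiam ht.le).trans_eq ?_
  rw [ENNReal.ofReal_rpow_of_nonneg (by positivity) ht.le, Real.mul_rpow zero_le_two
    (by positivity), ENNReal.ofReal_mul (by positivity), two_rpow_neg_mul_natCast]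

/-- The `t`-dimensional cost of a finite family of dyadic squares, in which `(k, z)` stands for the
square of side `2⁻ᵏ` with index `z`. -/
noncomputable def dyadicCost (t : ℝ) (T : Finset (ℕ × (ℤ × ℤ))) : ℝ :=
  ∑ τ ∈ T, (2 : ℝ) ^ (-(t * τ.1))

lemma exists_forall_exists_lt_dyadicCost {A : Set Plane} {t : ℝ} (ht : 0 < t) (hA : μH[t] A ≠ 0)
    {f : ℕ → ℝ} (hf : Summable f) :
    ∃ K₀ : ℕ, ∀ K ≥ K₀, ∀ T : ℕ → Finset (ℕ × (ℤ × ℤ)),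
      (∀ w ∈ A, ∃ k ≥ K, ∃ τ ∈ T k, gridIndex τ.1 w = τ.2) → ∃ k ≥ K, f k < dyadicCost t (T k) := by
  obtain ⟨c, hc, hcover⟩ := exists_pos_forall_le_tsum_ediam_rpow ht hA
  have htail : Filter.Tendsto
      (fun K => ENNReal.ofReal (2 ^ t) * ∑' n, ENNReal.ofReal (f (n + K))) Filter.atTop
      (nhds 0) := by
    have := ENNReal.Tendsto.const_mul (a := ENNReal.ofReal (2 ^ t))
      (ENNReal.tendsto_sum_nat_add _ hf.tsum_ofReal_ne_top) (.inr ENNReal.ofReal_ne_top)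
    rwa [mul_zero] at this
  obtain ⟨K₀, hK₀⟩ := Filter.eventually_atTop.1 (htail.eventually_lt_const hc)
  refine ⟨K₀, fun K hK T hT => ?_⟩
  by_contra! hcheap
  refine (hK₀ K hK).not_ge ?_
  have hcost (n : ℕ) : ∑' τ : T (n + K), ENNReal.ofReal (2 ^ (-(t * τ.1.1))) ≤
      ENNReal.ofReal (f (n + K)) := by
    rw [Finset.tsum_subtype (T (n + K)) fun τ => ENNReal.ofReal (2 ^ (-(t * τ.1))),
      ← ENNReal.ofReal_sum_of_nonneg fun τ _ => by positivity]
    exact ENNReal.ofReal_le_ofReal (hcheap _ (Nat.le_add_left _ _))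
  calc c ≤ ∑' i : Σ n : ℕ, T (n + K), Metric.ediam {w | gridIndex i.2.1.1 w = i.2.1.2} ^ t := by
        refine hcover _ _ fun w hw => ?_
        obtain ⟨k, hk, τ, hτ, hw⟩ := hT w hw
        obtain ⟨n, rfl⟩ := Nat.exists_eq_add_of_le' hk
        exact Set.mem_iUnion.2 ⟨⟨n, τ, hτ⟩, hw⟩
    _ ≤ ∑' i : Σ n : ℕ, T (n + K), ENNReal.ofReal (2 ^ t) * ENNReal.ofReal (2 ^ (-(t * i.2.1.1))) :=
      ENNReal.tsum_le_tsum fun i => ediam_gridIndex_fiber_rpow_le ht _ _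
    _ = ENNReal.ofReal (2 ^ t) *
        ∑' n, ∑' τ : T (n + K), ENNReal.ofReal (2 ^ (-(t * τ.1.1))) := by
      rw [ENNReal.tsum_mul_left, ENNReal.tsum_sigma']
    _ ≤ _ := by
      gcongr
      exact hcost _

/-- Every cover of `A` by dyadic squares of side at most `2⁻ᴷ` with `K ≥ K₀` uses more than
`2 ^ (σ k)` squares of some side `2⁻ᵏ`: a quantitative form of `dim A > σ`, in which the dependence
on `A` is only through `K₀`. -/
def IsDyadicallyLarge (σ : ℝ) (K₀ : ℕ) (A : Set Plane) : Prop :=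
  ∀ K ≥ K₀, ∀ S : ℕ → Finset (ℤ × ℤ), (∀ w ∈ A, ∃ k ≥ K, gridIndex k w ∈ S k) →
    ∃ k ≥ K, (2 : ℝ) ^ (σ * k) < #(S k)

lemma exists_isDyadicallyLarge {A : Set Plane} {σ : ℝ} (h : ENNReal.ofReal σ < dimH A) :
    ∃ K₀, IsDyadicallyLarge σ K₀ A := by
  obtain ⟨t, hσt, htA⟩ := ENNReal.lt_iff_exists_nnreal_btwn.1 h
  have hσ : σ < t := (Real.le_coe_toNNReal σ).trans_lt
    (NNReal.coe_lt_coe.2 (ENNReal.coe_lt_coe.1 hσt))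
  have ht : (0 : ℝ) < t := by exact_mod_cast pos_of_gt hσt
  have hA : μH[t] A ≠ 0 := by simp [hausdorffMeasure_of_lt_dimH htA]
  obtain ⟨K₀, hK₀⟩ := exists_forall_exists_lt_dyadicCost ht hA
    (summable_two_rpow_neg_mul (sub_pos.2 hσ))
  refine ⟨K₀, fun K hK S hS => ?_⟩
  obtain ⟨k, hk, hcost⟩ := hK₀ K hK (fun k => {k} ×ˢ S k) fun w hw => by
    obtain ⟨k, hk, hw⟩ := hS w hw
    exact ⟨k, hk, (k, gridIndex k w), by simpa using hw, rfl⟩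
  refine ⟨k, hk, ?_⟩
  simp only [dyadicCost, Finset.sum_product, Finset.sum_singleton, Finset.sum_const,
    nsmul_eq_mul] at hcost
  rw [Real.rpow_neg zero_le_two (t * k), ← div_eq_mul_inv, lt_div_iff₀ (by positivity),
    ← Real.rpow_add two_pos] at hcost
  rwa [show -((t - σ) * k) + t * k = σ * k by ring] at hcost

lemma exists_dyadic_scale {e : ENNReal} {K : ℕ} (he : e ≤ ENNReal.ofReal (1 / 2 ^ K)) (n : ℕ)
    {d : ℝ} (hd : 0 < d) :
    ∃ k ≥ K, e ≤ ENNReal.ofReal (1 / 2 ^ k) ∧ ENNReal.ofReal (2 ^ (-(d * k))) ≤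
      ENNReal.ofReal (2 ^ d) * (e ^ d + ENNReal.ofReal (2 ^ (-(d * n)))) := by
  lift e to NNReal using ne_top_of_le_ne_top ENNReal.ofReal_ne_top he
  rw [← ENNReal.ofReal_coe_nnreal, ENNReal.ofReal_le_ofReal_iff (by positivity)] at he
  set r : ℝ := max e (1 / 2 ^ (K + n)) with hr
  have hrK : r ≤ 1 / 2 ^ K := max_le he (by gcongr <;> simp)
  obtain ⟨k, hkr, hrk⟩ := exists_nat_pow_near_of_lt_one (y := (1 / 2 : ℝ)) (x := r) (by positivity)
    (hrK.trans (div_le_one_of_le₀ (one_le_pow₀ one_le_two) (by positivity))) (by norm_num)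
    (by norm_num)
  rw [one_div_pow] at hkr hrk
  have hKk : K ≤ k := by
    by_contra! hlt
    have : (1 : ℝ) / 2 ^ K ≤ 1 / 2 ^ (k + 1) := by gcongr; exacts [one_le_two, hlt]
    linarith
  have hkr' : 1 / 2 ^ k ≤ 2 * r := by
    rw [pow_succ, ← div_div] at hkr
    linarith
  refine ⟨k, hKk, ?_, ?_⟩
  · rw [← ENNReal.ofReal_coe_nnreal]
    exact ENNReal.ofReal_le_ofReal ((le_max_left _ _).trans hrk)
  have hreal : (2 : ℝ) ^ (-(d * k)) ≤ 2 ^ d * (e ^ d + 2 ^ (-(d * n))) := by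
    rw [two_rpow_neg_mul_natCast, two_rpow_neg_mul_natCast]
    calc (1 / 2 ^ k : ℝ) ^ d ≤ (2 * r) ^ d := by gcongr
      _ = 2 ^ d * r ^ d := Real.mul_rpow zero_le_two (by positivity)
      _ ≤ 2 ^ d * (e ^ d + (1 / 2 ^ n) ^ d) := by
        gcongr
        rw [hr, (Real.monotoneOn_rpow_Ici_of_exponent_nonneg hd.le).map_max
          (Set.mem_Ici.2 e.coe_nonneg) (Set.mem_Ici.2 (by positivity))]
        refine (max_le_add_of_nonneg (by positivity) (by positivity)).trans ?_
        gcongr <;> simp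
  rw [← ENNReal.ofReal_coe_nnreal, ENNReal.ofReal_rpow_of_nonneg e.coe_nonneg hd.le,
    ← ENNReal.ofReal_add (by positivity) (by positivity), ← ENNReal.ofReal_mul (by positivity)]
  exact ENNReal.ofReal_le_ofReal hreal

lemma exists_dyadic_cover_of_dimH_lt {A : Set Plane} {d : ℝ} (hd : 0 < d)
    (hA : dimH A < ENNReal.ofReal d) (K : ℕ) :
    ∃ (κ : ℕ → ℕ) (p : ℕ → Plane), (∀ n, K ≤ κ n) ∧
      (∀ w ∈ A, ∃ n, dist w (p n) ≤ 1 / 2 ^ κ n) ∧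
      ∑' n, ENNReal.ofReal (2 ^ (-(d * κ n))) ≤
        ENNReal.ofReal (2 ^ d) * (1 + ∑' n : ℕ, ENNReal.ofReal (2 ^ (-(d * n)))) := by
  have hμ : μH[d] A = 0 := by
    have := hausdorffMeasure_of_dimH_lt (d := d.toNNReal) hA
    rwa [Real.coe_toNNReal _ hd.le] at this
  obtain ⟨U, hU, hdiam, hsum⟩ := exists_cover_of_hausdorffMeasure_eq_zero hd hμ
    (r := ENNReal.ofReal (1 / 2 ^ K)) (ENNReal.ofReal_pos.2 (by positivity))
  choose κ hK hκ hcost using fun n => exists_dyadic_scale (hdiam n) n hd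
  have hpoint (n : ℕ) : ∃ p : Plane, ∀ w ∈ U n, dist w p ≤ 1 / 2 ^ κ n := by
    obtain hempty | ⟨p, hp⟩ := (U n).eq_empty_or_nonempty
    · exact ⟨0, by simp [hempty]⟩
    · refine ⟨p, fun w hw => ?_⟩
      have := (Metric.edist_le_ediam_of_mem hw hp).trans (hκ n)
      rwa [edist_dist, ENNReal.ofReal_le_ofReal_iff (by positivity)] at this
  choose p hp using hpoint
  refine ⟨κ, p, hK, fun w hw => (Set.mem_iUnion.1 (hU hw)).imp fun n => hp n w, ?_⟩
  refine (ENNReal.tsum_le_tsum hcost).trans ?_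
  rw [ENNReal.tsum_mul_left, ENNReal.tsum_add]
  gcongr

lemma exists_card_le_and_cover_of_dimH_lt {A : Set Plane} {d : ℝ} (hd : 0 < d)
    (hA : dimH A < ENNReal.ofReal d) :
    ∃ C : ℝ, 0 < C ∧ ∀ K : ℕ, ∃ S : ℕ → Finset (ℤ × ℤ),
      (∀ w ∈ A, ∃ k ≥ K, gridIndex k w ∈ S k) ∧ ∀ k, (#(S k) : ℝ) ≤ C * 2 ^ (d * k) := by
  classical
  set c : ENNReal := ENNReal.ofReal (2 ^ d) * (1 + ∑' n : ℕ, ENNReal.ofReal (2 ^ (-(d * n))))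
  have hc : c ≠ ⊤ := ENNReal.mul_ne_top ENNReal.ofReal_ne_top
    (ENNReal.add_ne_top.2 ⟨ENNReal.one_ne_top, (summable_two_rpow_neg_mul hd).tsum_ofReal_ne_top⟩)
  have hc₀ : 0 < c := ENNReal.mul_pos (ENNReal.ofReal_pos.2 (by positivity)).ne' (by simp)
  refine ⟨9 * c.toReal, mul_pos (by norm_num) (ENNReal.toReal_pos hc₀.ne' hc), fun K => ?_⟩
  obtain ⟨κ, p, hK, hcover, hsum⟩ := exists_dyadic_cover_of_dimH_lt hd hA K
  have hpos (k : ℕ) : (0 : ℝ) < 2 ^ (-(d * k)) := by positivity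
  choose hfin hcard using fun k : ℕ => ENNReal.finset_card_const_le_le_of_tsum_le hc hsum
    (ENNReal.ofReal_pos.2 (hpos k)).ne'
  refine ⟨fun k => (hfin k).toFinset.biUnion fun n => latticeBlock (gridIndex k (p n)) 1,
    fun w hw => ?_, fun k => ?_⟩
  · obtain ⟨n, hn⟩ := hcover w hw
    exact ⟨κ n, hK n, Finset.mem_biUnion.2 ⟨n, (hfin _).mem_toFinset.2 (le_refl (_ : ENNReal)),
      gridIndex_mem_latticeBlock (by rwa [Nat.cast_one])⟩⟩
  · have hblocks : (#((hfin k).toFinset.biUnion fun n =>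
        latticeBlock (gridIndex k (p n)) 1) : ℝ) ≤ #(hfin k).toFinset * 9 := by
      exact_mod_cast Finset.card_biUnion_le_card_mul _ _ 9 fun n _ => (card_latticeBlock _ _).le
    have hscale := ENNReal.toReal_mono
      (ENNReal.div_ne_top hc (ENNReal.ofReal_pos.2 (hpos k)).ne') (hcard k)
    have hdiv : c.toReal / 2 ^ (-(d * k)) = c.toReal * 2 ^ (d * k) := by
      rw [Real.rpow_neg zero_le_two, div_inv_eq_mul]
    rw [ENNReal.toReal_natCast, ENNReal.toReal_div, ENNReal.toReal_ofReal (hpos k).le,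
      hdiv] at hscale
    linarith

end HausdorffMeasure

/-! ### A discrete Frostman lemma -/

section Frostman

/-- `P` is a discrete `t`-dimensional Frostman set at scale `2⁻ᵐ`: a dyadic square of side `2⁻ˡ`,
with `l ≤ m`, contains at most `2 ^ (t (m - l))` points of `P`. -/
def IsFrostman (t : ℝ) (m : ℕ) (P : Finset Plane) : Prop :=
  ∀ l ≤ m, ∀ z, (#{p ∈ P | gridIndex l p = z} : ℝ) ≤ 2 ^ (t * (m - l))

/-- The dyadic square of side `2⁻ˡ` around `w` is saturated by `P`: one more point in it would
violate the bound in `IsFrostman`. -/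
def IsSaturated (t : ℝ) (m : ℕ) (P : Finset Plane) (l : ℕ) (w : Plane) : Prop :=
  (2 : ℝ) ^ (t * (m - l)) < #{p ∈ P | gridIndex l p = gridIndex l w} + 1

variable {t : ℝ} {m : ℕ} {P : Finset Plane}

lemma IsSaturated.congr {l : ℕ} {w w' : Plane} (h : IsSaturated t m P l w)
    (hw : gridIndex l w = gridIndex l w') : IsSaturated t m P l w' := by
  rwa [IsSaturated, ← hw]

lemma isSaturated_self {p : Plane} (hp : p ∈ P) : IsSaturated t m P m p := by
  have : 0 < #{q ∈ P | gridIndex m q = gridIndex m p} :=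
    Finset.card_pos.2 ⟨p, Finset.mem_filter.2 ⟨hp, rfl⟩⟩
  rw [IsSaturated, sub_self, mul_zero, Real.rpow_zero]
  exact_mod_cast Nat.lt_add_of_pos_left this

lemma IsSaturated.two_rpow_le {l : ℕ} {p : Plane} (h : IsSaturated t m P l p) (hp : p ∈ P) :
    (2 : ℝ) ^ (-(t * l)) ≤ 2 * 2 ^ (-(t * m)) * #{q ∈ P | gridIndex l q = gridIndex l p} := by
  have hpos : 0 < #{q ∈ P | gridIndex l q = gridIndex l p} :=
    Finset.card_pos.2 ⟨p, Finset.mem_filter.2 ⟨hp, rfl⟩⟩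
  rw [← Nat.succ_le_iff, ← Nat.cast_le (α := ℝ), Nat.cast_succ] at hpos
  rw [IsSaturated] at h
  calc (2 : ℝ) ^ (-(t * l)) = 2 ^ (-(t * m)) * 2 ^ (t * (m - l)) := by
        rw [← Real.rpow_add two_pos]
        ring_nf
    _ ≤ 2 ^ (-(t * m)) * (2 * #{q ∈ P | gridIndex l q = gridIndex l p}) := by
        gcongr
        linarith
    _ = _ := by ring

lemma IsSaturated.exists_gridIndex_eq {l : ℕ} {w : Plane} (h : IsSaturated t m P l w) (ht : 0 ≤ t)
    (hl : l ≤ m) : ∃ p ∈ P, gridIndex l p = gridIndex l w := by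
  have hpow : (1 : ℝ) ≤ 2 ^ (t * (m - l)) := Real.one_le_rpow one_le_two
    (mul_nonneg ht (sub_nonneg.2 (Nat.cast_le.2 hl)))
  have hpos := (lt_add_iff_pos_left (1 : ℝ)).1 (hpow.trans_lt h)
  obtain ⟨p, hp⟩ := Finset.card_pos.1 (Nat.cast_pos.1 hpos)
  exact ⟨p, Finset.mem_filter.1 hp⟩

lemma isFrostman_empty (t : ℝ) (m : ℕ) : IsFrostman t m ∅ := by
  intro l _ z
  rw [Finset.filter_empty, Finset.card_empty, Nat.cast_zero]
  positivity

lemma IsFrostman.exists_isSaturated_of_not_insert (hP : IsFrostman t m P) {w : Plane}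
    (hw : ¬ IsFrostman t m (insert w P)) : ∃ l ≤ m, IsSaturated t m P l w := by
  simp only [IsFrostman, not_forall, not_le] at hw
  obtain ⟨l, hl, z, hz⟩ := hw
  rw [Finset.filter_insert] at hz
  split_ifs at hz with hwz
  · refine ⟨l, hl, hz.trans_le ?_⟩
    rw [hwz]
    exact_mod_cast Finset.card_insert_le _ _
  · exact absurd (hP l hl z) hz.not_ge

lemma exists_isFrostman_forall_exists_isSaturated {A : Set Plane} {z₀ : ℤ × ℤ}
    (hA : ∀ w ∈ A, gridIndex 0 w = z₀) (t : ℝ) (m : ℕ) :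
    ∃ P : Finset Plane, ↑P ⊆ A ∧ IsFrostman t m P ∧
      ∀ w ∈ A, ∃ l ≤ m, IsSaturated t m P l w := by
  set cards : Set ℕ := {n | ∃ P : Finset Plane, ↑P ⊆ A ∧ IsFrostman t m P ∧ #P = n}
  have hne : cards.Nonempty := ⟨0, ∅, by simp, isFrostman_empty t m, rfl⟩
  have hbdd : BddAbove cards := by
    refine ⟨⌊(2 : ℝ) ^ (t * m)⌋₊, ?_⟩
    rintro _ ⟨P, hPA, hP, rfl⟩
    have := hP 0 m.zero_le z₀
    rw [Finset.filter_true_of_mem fun p hp => hA p (hPA hp), Nat.cast_zero, sub_zero] at this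
    exact Nat.le_floor this
  obtain ⟨P, hPA, hP, hcard⟩ := Nat.sSup_mem hne hbdd
  refine ⟨P, hPA, hP, fun w hw => ?_⟩
  by_cases hwP : w ∈ P
  · exact ⟨m, le_rfl, isSaturated_self hwP⟩
  · refine hP.exists_isSaturated_of_not_insert fun hins => ?_
    have := le_csSup hbdd ⟨insert w P, by
      rw [Finset.coe_insert]
      exact Set.insert_subset hw hPA, hins, rfl⟩
    rw [Finset.card_insert_of_notMem hwP, ← hcard] at this
    omega

lemma exists_dyadicCost_le_of_forall_exists_isSaturated (ht : 0 ≤ t) {A : Set Plane}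
    (hA : ∀ w ∈ A, ∃ l ≤ m, IsSaturated t m P l w) :
    ∃ T : Finset (ℕ × (ℤ × ℤ)), (∀ w ∈ A, ∃ τ ∈ T, gridIndex τ.1 w = τ.2) ∧
      dyadicCost t T ≤ 2 * 2 ^ (-(t * m)) * #P := by
  classical
  -- The squares in `T` are the largest saturated ones, hence pairwise disjoint.
  set coarsest : Plane → ℕ := fun p => sInf {l | IsSaturated t m P l p}
  set square : Plane → ℕ × (ℤ × ℤ) := fun p => (coarsest p, gridIndex (coarsest p) p)
  have hsat {p : Plane} (hp : p ∈ P) : IsSaturated t m P (coarsest p) p :=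
    Nat.sInf_mem (s := {l | IsSaturated t m P l p}) ⟨m, isSaturated_self hp⟩
  have hle {p q : Plane} {l : ℕ} (h : IsSaturated t m P l q) (hpq : gridIndex l q = gridIndex l p) :
      coarsest p ≤ l := Nat.sInf_le (h.congr hpq)
  have hsquare {p q : Plane} (hp : p ∈ P) (hq : q ∈ P)
      (h : gridIndex (coarsest q) p = gridIndex (coarsest q) q) : square p = square q := by
    have hpq := hle (hsat hq) h.symm
    have heq := hpq.antisymm (hle (hsat hp) (gridIndex_eq_of_le hpq h))
    simp only [square, heq, h]
  refine ⟨P.image square, fun w hw => ?_, ?_⟩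
  · obtain ⟨l, hl, hwl⟩ := hA w hw
    obtain ⟨p, hp, hpw⟩ := hwl.exists_gridIndex_eq ht hl
    exact ⟨square p, Finset.mem_image_of_mem _ hp,
      gridIndex_eq_of_le (hle hwl hpw.symm) hpw.symm⟩
  · rw [Finset.card_eq_sum_card_image square, dyadicCost, Nat.cast_sum, Finset.mul_sum]
    refine Finset.sum_le_sum fun τ hτ => ?_
    obtain ⟨q, hq, rfl⟩ := Finset.mem_image.1 hτ
    refine ((hsat hq).two_rpow_le hq).trans ?_
    gcongr 2 * 2 ^ (-(t * m)) * (#?_ : ℝ)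
    intro p hp
    obtain ⟨hpP, hpq⟩ := Finset.mem_filter.1 hp
    exact Finset.mem_filter.2 ⟨hpP, hsquare hpP hq hpq⟩

end Frostman

/-! ### The energy of the visible parts -/

section Energy

lemma sum_card_eq_sum_card_filter_mem {α β : Type*} [DecidableEq β] (P : Finset α) (S : Finset β)
    (A : α → Finset β) (hA : ∀ x ∈ P, A x ⊆ S) :
    ∑ x ∈ P, #(A x) = ∑ z ∈ S, #{x ∈ P | z ∈ A x} := by
  refine Eq.trans (Finset.sum_congr rfl fun x hx => ?_)
    (Finset.sum_card_bipartiteAbove_eq_sum_card_bipartiteBelow fun x z => z ∈ A x)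
  rw [Finset.bipartiteAbove, Finset.filter_mem_eq_inter, Finset.inter_eq_right.2 (hA x hx)]

lemma sq_sum_card_le {α β : Type*} [DecidableEq β] (P : Finset α) (S : Finset β)
    (A : α → Finset β) (hA : ∀ x ∈ P, A x ⊆ S) :
    (∑ x ∈ P, #(A x)) ^ 2 ≤ #S * ∑ x ∈ P, ∑ y ∈ P, #(A x ∩ A y) := by
  have hsq : ∑ x ∈ P, ∑ y ∈ P, #(A x ∩ A y) = ∑ z ∈ S, #{x ∈ P | z ∈ A x} ^ 2 := by
    rw [← Finset.sum_product', sum_card_eq_sum_card_filter_mem (P ×ˢ P) S fun q => A q.1 ∩ A q.2]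
    · simp_rw [sq, ← Finset.card_product, ← Finset.filter_product, Finset.mem_inter]
    · exact fun q hq => Finset.inter_subset_left.trans (hA _ (Finset.mem_product.1 hq).1)
  rw [sum_card_eq_sum_card_filter_mem P S A hA, hsq]
  exact sq_sum_le_card_mul_sum_sq

lemma card_mul_sq_le_of_sum_card_inter_le {α β : Type*} [DecidableEq β] {P : Finset α}
    {S : Finset β} {A : α → Finset β} (hA : ∀ x ∈ P, A x ⊆ S) {M E c : ℝ} (hM : 0 < M)
    (hE : 0 ≤ E) (hc : 0 ≤ c) (hMA : ∀ x ∈ P, M ≤ #(A x))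
    (hrow : ∀ x ∈ P, ∑ y ∈ P, (#(A x ∩ A y) : ℝ) ≤ c * (#(A x) + E)) :
    #P * M ^ 2 ≤ c * #S * (M + E) := by
  obtain rfl | hne := P.eq_empty_or_nonempty
  · rw [Finset.card_empty, Nat.cast_zero, zero_mul]
    positivity
  have hP : (0 : ℝ) < #P := Nat.cast_pos.2 hne.card_pos
  set G : ℝ := ∑ x ∈ P, (#(A x) : ℝ)
  have hPG : #P * M ≤ G := by
    rw [← nsmul_eq_mul]
    exact Finset.card_nsmul_le_sum P _ M hMA
  have hG : 0 < G := (mul_pos hP hM).trans_le hPG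
  have henergy : G ^ 2 ≤ #S * (c * (G + #P * E)) := by
    calc G ^ 2 ≤ #S * ∑ x ∈ P, ∑ y ∈ P, (#(A x ∩ A y) : ℝ) := by
          simp only [G]
          exact_mod_cast sq_sum_card_le P S A hA
      _ ≤ #S * ∑ x ∈ P, c * (#(A x) + E) := by
          gcongr with x hx
          exact hrow x hx
      _ = #S * (c * (G + #P * E)) := by
          rw [← Finset.mul_sum, Finset.sum_add_distrib, Finset.sum_const, nsmul_eq_mul]
  have hGM : G * M ≤ c * #S * (M + E) := by
    refine le_of_mul_le_mul_left ?_ hG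
    calc G * (G * M) = G ^ 2 * M := by ring
      _ ≤ #S * (c * (G + #P * E)) * M := by gcongr
      _ = c * #S * (G * M + #P * M * E) := by ring
      _ ≤ c * #S * (G * M + G * E) := by gcongr
      _ = G * (c * #S * (M + E)) := by ring
  calc #P * M ^ 2 = #P * M * M := by ring
    _ ≤ G * M := by gcongr
    _ ≤ c * #S * (M + E) := hGM

lemma IsFrostman.card_filter_dist_le {P : Finset Plane} {t : ℝ} {m l : ℕ} (hP : IsFrostman t m P)
    (hl : l ≤ m) (x : Plane) :
    (#{y ∈ P | dist y x ≤ 2 / 2 ^ l} : ℝ) ≤ 25 * 2 ^ (t * (m - l)) := by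
  classical
  refine card_le_mul_of_forall_fiber_le _ (gridIndex l) (by positivity) (fun z => ?_) ?_
  · refine (Nat.cast_le.2 (Finset.card_le_card ?_)).trans (hP l hl z)
    exact Finset.filter_subset_filter _ (Finset.filter_subset _ _)
  · have hblock : ({y ∈ P | dist y x ≤ 2 / 2 ^ l}).image (gridIndex l) ⊆
        latticeBlock (gridIndex l x) 2 := by
      refine Finset.image_subset_iff.2 fun y hy => gridIndex_mem_latticeBlock ?_
      exact_mod_cast (Finset.mem_filter.1 hy).2
    have := Finset.card_le_card hblock
    rw [card_latticeBlock] at this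
    exact_mod_cast this

lemma exists_dyadic_annulus {ρ : ℝ} (hρ : ρ ≤ 2) (m : ℕ) :
    ∃ l ≤ m, ρ ≤ 2 / 2 ^ l ∧ (1 / 2 ^ l ≤ ρ ∨ l = m) := by
  induction m with
  | zero => exact ⟨0, le_rfl, by rwa [pow_zero, div_one], Or.inr rfl⟩
  | succ m ih =>
    obtain ⟨l, hl, hρl, hlρ⟩ := ih
    by_cases h : 1 / 2 ^ l ≤ ρ
    · exact ⟨l, hl.trans m.le_succ, hρl, Or.inl h⟩
    · obtain rfl := hlρ.resolve_left h
      refine ⟨l + 1, le_rfl, ?_, Or.inr rfl⟩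
      rw [pow_succ', mul_comm, ← div_div, div_right_comm, div_self two_ne_zero]
      exact (not_le.1 h).le

lemma le_sum_dyadic_annuli {g ρ M B : ℝ} (hρ : ρ ≤ 2) (hM : 0 ≤ M) (hB : 0 ≤ B) (hgM : g ≤ M)
    (hgB : g * ρ ≤ B) (m : ℕ) :
    g ≤ (if ρ ≤ 2 / 2 ^ m then M else 0) +
      ∑ l ∈ Finset.range (m + 1), if ρ ≤ 2 / 2 ^ l then B * 2 ^ l else 0 := by
  have hterm (l : ℕ) : 0 ≤ if ρ ≤ 2 / 2 ^ l then B * 2 ^ l else 0 := by split_ifs <;> positivity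
  obtain ⟨l, hl, hρl, hlρ | rfl⟩ := exists_dyadic_annulus hρ m
  · have hg : g ≤ B * 2 ^ l := by
      obtain hg | hg := le_or_gt g 0
      · exact hg.trans (by positivity)
      · have := (mul_le_mul_of_nonneg_left hlρ hg.le).trans hgB
        rwa [mul_one_div, div_le_iff₀ (by positivity)] at this
    have hsingle := Finset.single_le_sum (fun l _ => hterm l)
      (Finset.mem_range.2 (Nat.lt_succ_of_le hl))
    rw [if_pos hρl] at hsingle
    exact (hg.trans hsingle).trans (le_add_of_nonneg_left (by split_ifs <;> positivity))
  · rw [if_pos hρl]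
    exact le_add_of_le_of_nonneg hgM (Finset.sum_nonneg fun l _ => hterm l)

lemma IsFrostman.sum_le {P : Finset Plane} {t : ℝ} {m : ℕ} (hP : IsFrostman t m P) (ht : t ≤ 1)
    {x : Plane} (hx : ∀ y ∈ P, dist y x ≤ 2) {g : Plane → ℝ} {M B : ℝ} (hM : 0 ≤ M) (hB : 0 ≤ B)
    (hgM : ∀ y ∈ P, g y ≤ M) (hgB : ∀ y ∈ P, g y * dist y x ≤ B) :
    ∑ y ∈ P, g y ≤ 25 * (M + (m + 1) * B * 2 ^ m) := by
  have hball {l : ℕ} (hl : l ≤ m) {b : ℝ} (hb : 0 ≤ b) :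
      ∑ y ∈ P, (if dist y x ≤ 2 / 2 ^ l then b else 0) ≤ 25 * 2 ^ (m - l) * b := by
    rw [← Finset.sum_filter, Finset.sum_const, nsmul_eq_mul]
    refine mul_le_mul_of_nonneg_right ((hP.card_filter_dist_le hl x).trans ?_) hb
    rw [← Real.rpow_natCast 2 (m - l), Nat.cast_sub hl]
    gcongr
    · exact one_le_two
    · exact mul_le_of_le_one_left (sub_nonneg.2 (Nat.cast_le.2 hl)) ht
  have hannuli : ∑ l ∈ Finset.range (m + 1),
      ∑ y ∈ P, (if dist y x ≤ 2 / 2 ^ l then B * 2 ^ l else 0) ≤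
        (m + 1 : ℕ) • (25 * (B * 2 ^ m)) := by
    refine (Finset.sum_le_card_nsmul _ _ _ fun l hl => ?_).trans_eq (by rw [Finset.card_range])
    have hlm := Nat.lt_succ_iff.1 (Finset.mem_range.1 hl)
    refine (hball hlm (by positivity)).trans_eq ?_
    rw [← Nat.sub_add_cancel hlm, pow_add, Nat.add_sub_cancel]
    ring
  have hnear := hball le_rfl hM
  rw [Nat.sub_self, pow_zero, mul_one] at hnear
  calc ∑ y ∈ P, g y ≤ _ := Finset.sum_le_sum fun y hy =>
        le_sum_dyadic_annuli (hx y hy) hM hB (hgM y hy) (hgB y hy) m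
    _ ≤ 25 * M + (m + 1 : ℕ) • (25 * (B * 2 ^ m)) := by
        rw [Finset.sum_add_distrib, Finset.sum_comm]
        exact add_le_add hnear hannuli
    _ = 25 * (M + (m + 1) * B * 2 ^ m) := by
        rw [nsmul_eq_mul, Nat.cast_succ]
        ring

end Energy

/-! ### Exceptional viewpoints -/

section Dimension

open MeasureTheory MeasureTheory.Measure

/-- The members of the family `S` of dyadic squares of side `2⁻ᵏ` that meet the part of `Γ` visible
from `x` within distance `2ʳ`. -/
noncomputable def visibleSquares (Γ : Set Plane) (r k : ℕ) (S : Finset (ℤ × ℤ)) (x : Plane) :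
    Finset (ℤ × ℤ) :=
  open Classical in
  {z ∈ S | z ∈ gridIndex k '' (visiblePart Γ x ∩ Metric.closedBall x (2 ^ r))}

lemma mem_visibleSquares {Γ : Set Plane} {r k : ℕ} {S : Finset (ℤ × ℤ)} {x : Plane} {z : ℤ × ℤ} :
    z ∈ visibleSquares Γ r k S x ↔
      z ∈ S ∧ z ∈ gridIndex k '' (visiblePart Γ x ∩ Metric.closedBall x (2 ^ r)) := by
  simp only [visibleSquares, Finset.mem_filter]

lemma visibleSquares_subset (Γ : Set Plane) (r k : ℕ) (S : Finset (ℤ × ℤ)) (x : Plane) :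
    visibleSquares Γ r k S x ⊆ S :=
  fun _ hz => (mem_visibleSquares.1 hz).1

lemma card_visibleSquares_inter_le {Γ : Set Plane} (hΓ : IsPreconnected Γ) {r : ℕ} {x y : Plane}
    (hxy : x ≠ y) (hr : dist x y ≤ 2 ^ r) (k : ℕ) (S : Finset (ℤ × ℤ)) :
    (#(visibleSquares Γ r k S x ∩ visibleSquares Γ r k S y) : ℝ) ≤
      2000000 * (k + r + 2) ^ 2 * (2 ^ r) ^ 2 * 2 ^ k / dist x y := by
  set Z := visibleSquares Γ r k S x ∩ visibleSquares Γ r k S y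
  have hx : ∀ z ∈ Z, z ∈ gridIndex k '' (visiblePart Γ x ∩ Metric.closedBall x (2 ^ r)) :=
    fun z hz => (mem_visibleSquares.1 (Finset.mem_inter.1 hz).1).2
  have hy : ∀ z ∈ Z, z ∈ gridIndex k '' (visiblePart Γ y ∩ Metric.closedBall y (2 ^ r)) :=
    fun z hz => (mem_visibleSquares.1 (Finset.mem_inter.1 hz).2).2
  choose! u hu hux using hx
  choose! v hv hvy using hy
  have hmarking : IsMarking Γ x y (2 ^ r) k Z u v :=
    ⟨hux, hvy, fun z hz => (hu z hz).1, fun z hz => (hv z hz).1,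
      fun z hz => (hu z hz).2, fun z hz => (hv z hz).2⟩
  have hpow : (2 : ℝ) ^ r * 2 ^ k = 2 ^ (k + r) := by rw [← pow_add, add_comm]
  have := hmarking.card_le hxy hΓ hr hpow.le (hpow ▸ one_le_pow₀ one_le_two)
  rwa [Nat.cast_add] at this

lemma exists_cover_dyadicCost_mul_sq_le {Γ : Set Plane} (hΓ : IsPreconnected Γ) {r : ℕ}
    (hr : 1 ≤ r) (k m : ℕ) (S : Finset (ℤ × ℤ)) {t M : ℝ} (ht₀ : 0 ≤ t) (ht₁ : t ≤ 1)
    (hM : 0 < M) {A : Set Plane} {z₀ : ℤ × ℤ} (hA : ∀ w ∈ A, gridIndex 0 w = z₀)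
    (hMA : ∀ w ∈ A, M ≤ #(visibleSquares Γ r k S w)) :
    ∃ T : Finset (ℕ × (ℤ × ℤ)), (∀ w ∈ A, ∃ τ ∈ T, gridIndex τ.1 w = τ.2) ∧
      dyadicCost t T * M ^ 2 ≤ 50 * 2 ^ (-(t * m)) * #S *
        (M + (m + 1) * (2000000 * (k + r + 2) ^ 2 * (2 ^ r) ^ 2 * 2 ^ k) * 2 ^ m) := by
  obtain ⟨P, hPA, hP, hsat⟩ := exists_isFrostman_forall_exists_isSaturated hA t m
  obtain ⟨T, hT, hcost⟩ := exists_dyadicCost_le_of_forall_exists_isSaturated ht₀ hsat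
  refine ⟨T, hT, ?_⟩
  have hdist {x y : Plane} (hx : x ∈ P) (hy : y ∈ P) : dist x y ≤ 2 := by
    have := dist_le_of_gridIndex_eq ((hA x (hPA hx)).trans (hA y (hPA hy)).symm)
    rwa [pow_zero, div_one] at this
  have hP_card := card_mul_sq_le_of_sum_card_inter_le (P := P) (c := 25)
    (E := (m + 1) * (2000000 * (k + r + 2) ^ 2 * (2 ^ r) ^ 2 * 2 ^ k) * 2 ^ m)
    (fun x _ => visibleSquares_subset Γ r k S x) hM (by positivity) (by norm_num)
    (fun x hx => hMA x (hPA hx)) fun x hx => by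
      refine hP.sum_le ht₁ (fun y hy => hdist hy hx) (by positivity) (by positivity)
        (fun y _ => Nat.cast_le.2 (Finset.card_le_card Finset.inter_subset_left)) fun y hy => ?_
      obtain rfl | hxy := eq_or_ne x y
      · rw [dist_self, mul_zero]
        positivity
      · rw [dist_comm, ← le_div_iff₀ (dist_pos.2 hxy)]
        exact card_visibleSquares_inter_le hΓ hxy
          ((hdist hx hy).trans (le_self_pow₀ one_le_two (by omega))) k S
  calc dyadicCost t T * M ^ 2 ≤ 2 * 2 ^ (-(t * m)) * #P * M ^ 2 := by gcongr
    _ = 2 * 2 ^ (-(t * m)) * (#P * M ^ 2) := by ring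
    _ ≤ 2 * 2 ^ (-(t * m)) * (25 * #S * _) := by gcongr
    _ = _ := by ring

lemma add_mul_two_pow_le {s ε : ℝ} (hs₁ : 1 ≤ s) (hs₂ : s ≤ 2) (hε : 0 ≤ ε) (k r : ℕ) :
    (2 : ℝ) ^ ((s - ε) * k) + (⌊k * (s - 1)⌋₊ + 1) *
        (2000000 * (k + r + 2) ^ 2 * (2 ^ r) ^ 2 * 2 ^ k) * 2 ^ ⌊k * (s - 1)⌋₊ ≤
      2000001 * (2 ^ r) ^ 2 * (k + r + 2) ^ 3 * 2 ^ (s * k) := by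
  set m := ⌊k * (s - 1)⌋₊
  have hm : (m : ℝ) ≤ k * (s - 1) := Nat.floor_le (by nlinarith)
  have hmk : (m : ℝ) + 1 ≤ k + r + 2 := by nlinarith
  have hpow : (2 : ℝ) ^ k * 2 ^ m ≤ 2 ^ (s * k) := by
    rw [← Real.rpow_natCast 2 k, ← Real.rpow_natCast 2 m, ← Real.rpow_add two_pos]
    exact Real.rpow_le_rpow_of_exponent_le one_le_two (by linarith)
  have hfirst : (2 : ℝ) ^ ((s - ε) * k) ≤ (2 ^ r) ^ 2 * (k + r + 2) ^ 3 * 2 ^ (s * k) := by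
    have hX : (1 : ℝ) ≤ (2 ^ r) ^ 2 * (k + r + 2) ^ 3 :=
      one_le_mul_of_one_le_of_one_le (one_le_pow₀ (one_le_pow₀ one_le_two))
        (one_le_pow₀ (by linarith))
    refine (Real.rpow_le_rpow_of_exponent_le one_le_two ?_).trans
      (le_mul_of_one_le_left (by positivity) hX)
    gcongr
    linarith
  calc _ ≤ (2 ^ r) ^ 2 * (k + r + 2) ^ 3 * (2 : ℝ) ^ (s * k) +
        (m + 1) * (2000000 * (k + r + 2) ^ 2 * (2 ^ r) ^ 2) * (2 ^ k * 2 ^ m) := by linarith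
    _ ≤ (2 ^ r) ^ 2 * (k + r + 2) ^ 3 * (2 : ℝ) ^ (s * k) +
        (k + r + 2) * (2000000 * (k + r + 2) ^ 2 * (2 ^ r) ^ 2) * 2 ^ (s * k) := by gcongr
    _ = _ := by ring

lemma two_rpow_neg_mul_floor_le {s t : ℝ} (ht₀ : 0 ≤ t) (ht₁ : t ≤ 1) (k : ℕ) :
    (2 : ℝ) ^ (-(t * ⌊k * (s - 1)⌋₊)) ≤ 2 * 2 ^ (-(t * (s - 1) * k)) := by
  have hfloor := mul_le_mul_of_nonneg_left (Nat.lt_floor_add_one (k * (s - 1))).le ht₀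
  calc (2 : ℝ) ^ (-(t * ⌊k * (s - 1)⌋₊)) ≤ 2 ^ (1 + -(t * (s - 1) * k)) :=
        Real.rpow_le_rpow_of_exponent_le one_le_two (by linarith)
    _ = 2 * 2 ^ (-(t * (s - 1) * k)) := by rw [Real.rpow_add two_pos, Real.rpow_one]

lemma exists_cover_dyadicCost_le {Γ : Set Plane} (hΓ : IsPreconnected Γ) {r : ℕ} (hr : 1 ≤ r)
    {d s t ε C : ℝ} (hs₁ : 1 ≤ s) (hs₂ : s ≤ 2) (ht₀ : 0 ≤ t) (ht₁ : t ≤ 1) (hε : 0 ≤ ε) {k : ℕ}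
    {S : Finset (ℤ × ℤ)} (hS : #S ≤ C * 2 ^ ((d + ε) * k)) {A : Set Plane} {z₀ : ℤ × ℤ}
    (hA : ∀ w ∈ A, gridIndex 0 w = z₀)
    (hlarge : ∀ w ∈ A, 2 ^ ((s - ε) * k) ≤ (#(visibleSquares Γ r k S w) : ℝ)) :
    ∃ T : Finset (ℕ × (ℤ × ℤ)), (∀ w ∈ A, ∃ τ ∈ T, gridIndex τ.1 w = τ.2) ∧
      dyadicCost t T ≤ 200000100 * C * (2 ^ r) ^ 2 * (k + r + 2) ^ 3 *
        2 ^ (-((t * (s - 1) + s - d - 3 * ε) * k)) := by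
  obtain ⟨T, hT, hcost⟩ := exists_cover_dyadicCost_mul_sq_le hΓ hr k ⌊k * (s - 1)⌋₊ S ht₀ ht₁
    (by positivity) hA hlarge
  refine ⟨T, hT, ?_⟩
  have hM : (0 : ℝ) < (2 ^ ((s - ε) * k)) ^ 2 := by positivity
  refine le_of_mul_le_mul_right (hcost.trans ?_) hM
  have hsize : (0 : ℝ) ≤ C * 2 ^ ((d + ε) * k) := (Nat.cast_nonneg _).trans hS
  calc _ ≤ 50 * (2 * (2 : ℝ) ^ (-(t * (s - 1) * k))) * (C * 2 ^ ((d + ε) * k)) *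
        (2000001 * (2 ^ r) ^ 2 * (k + r + 2) ^ 3 * 2 ^ (s * k)) := by
        gcongr
        · exact two_rpow_neg_mul_floor_le ht₀ ht₁ k
        · exact add_mul_two_pow_le hs₁ hs₂ hε k r
    _ = 200000100 * C * (2 ^ r) ^ 2 * (k + r + 2) ^ 3 *
        (2 ^ (-(t * (s - 1) * k)) * 2 ^ ((d + ε) * k) * 2 ^ (s * k)) := by ring
    _ = 200000100 * C * (2 ^ r) ^ 2 * (k + r + 2) ^ 3 *
        (2 ^ (-((t * (s - 1) + s - d - 3 * ε) * k)) * (2 ^ ((s - ε) * k)) ^ 2) := by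
        rw [sq (2 ^ ((s - ε) * k))]
        simp only [← Real.rpow_add two_pos]
        ring_nf
    _ = _ := by ring

lemma summable_mul_cube_mul_two_rpow_neg (c : ℝ) (a : ℕ) {δ : ℝ} (hδ : 0 < δ) :
    Summable fun k : ℕ => c * (k + a : ℝ) ^ 3 * 2 ^ (-(δ * k)) := by
  have hlt : ‖(2 : ℝ) ^ (-δ)‖ < 1 := by
    rw [Real.norm_of_nonneg (by positivity)]
    exact Real.rpow_lt_one_of_one_lt_of_neg one_lt_two (neg_lt_zero.2 hδ)
  have hsum : Summable fun k : ℕ => ((k + a : ℕ) : ℝ) ^ 3 * ((2 : ℝ) ^ (-δ)) ^ (k + a) :=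
    (summable_nat_add_iff (f := fun n : ℕ => (n : ℝ) ^ 3 * ((2 : ℝ) ^ (-δ)) ^ n) a).2
      (summable_pow_mul_geometric_of_norm_lt_one 3 hlt)
  refine (hsum.mul_left (c * 2 ^ (δ * a))).congr fun k => ?_
  have hpow : (2 : ℝ) ^ (δ * a) * ((2 : ℝ) ^ (-δ)) ^ (k + a) = 2 ^ (-(δ * k)) := by
    rw [← Real.rpow_mul_natCast zero_le_two, ← Real.rpow_add two_pos]
    push_cast
    ring_nf
  rw [← hpow, Nat.cast_add]
  ring

lemma hausdorffMeasure_eq_zero_of_isDyadicallyLarge {Γ : Set Plane} (hΓ : IsPreconnected Γ)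
    {d s t ε : ℝ} (hdε : 0 < d + ε) (hd : dimH Γ < ENNReal.ofReal (d + ε)) (hs₁ : 1 ≤ s)
    (hs₂ : s ≤ 2) (ht₀ : 0 < t) (ht₁ : t ≤ 1) (hε : 0 ≤ ε)
    (hgap : 3 * ε < t * (s - 1) + s - d) {F : Set Plane} {z₀ : ℤ × ℤ}
    (hF : ∀ x ∈ F, gridIndex 0 x = z₀) {r K₀ : ℕ} (hr : 1 ≤ r)
    (hlarge : ∀ x ∈ F,
      IsDyadicallyLarge (s - ε) K₀ (visiblePart Γ x ∩ Metric.closedBall x (2 ^ r))) :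
    μH[t] F = 0 := by
  by_contra hpos
  obtain ⟨C, -, hcover⟩ := exists_card_le_and_cover_of_dimH_lt hdε hd
  obtain ⟨K₁, hK₁⟩ := exists_forall_exists_lt_dyadicCost ht₀ hpos
    (summable_mul_cube_mul_two_rpow_neg (200000100 * C * (2 ^ r) ^ 2) (r + 2) (sub_pos.2 hgap))
  obtain ⟨S, hScover, hScard⟩ := hcover (max K₀ K₁)
  have hscale (k : ℕ) := exists_cover_dyadicCost_le hΓ hr hs₁ hs₂ ht₀.le ht₁ hε (hScard k)
    (A := {x ∈ F | 2 ^ ((s - ε) * k) ≤ (#(visibleSquares Γ r k (S k) x) : ℝ)})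
    (fun x hx => hF x hx.1) fun x hx => hx.2
  choose T hT hcost using hscale
  obtain ⟨k, -, hk⟩ := hK₁ (max K₀ K₁) (le_max_right _ _) T fun x hx => by
    obtain ⟨k, hk, hkx⟩ := hlarge x hx _ (le_max_left _ _)
      (fun k => visibleSquares Γ r k (S k) x) fun w hw =>
        (hScover w hw.1.1).imp fun k => And.imp_right fun h => mem_visibleSquares.2 ⟨h, w, hw, rfl⟩
    exact ⟨k, hk, hT k x ⟨hx, hkx.le⟩⟩
  refine hk.not_ge ((hcost k).trans_eq ?_)
  push_cast
  ring

lemma dimH_toReal_le_two (A : Set Plane) : (dimH A).toReal ≤ 2 := by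
  refine ENNReal.toReal_le_of_le_ofReal zero_le_two ((dimH_mono (Set.subset_univ A)).trans ?_)
  rw [Real.dimH_univ_eq_finrank, finrank_euclideanSpace_fin]
  norm_num

lemma exists_isDyadicallyLarge_inter_closedBall {σ : ℝ} {A : Set Plane}
    (hσ : ENNReal.ofReal σ < dimH A) (x : Plane) :
    ∃ r K₀ : ℕ, IsDyadicallyLarge σ K₀ (A ∩ Metric.closedBall x (2 ^ (r + 1))) := by
  have hA : A ⊆ ⋃ r : ℕ, A ∩ Metric.closedBall x (2 ^ (r + 1)) := fun u hu => by
    obtain ⟨r, hr⟩ := pow_unbounded_of_one_lt (dist u x) one_lt_two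
    exact Set.mem_iUnion.2
      ⟨r, hu, hr.le.trans (pow_le_pow_right₀ one_le_two r.le_succ)⟩
  have hlt := hσ.trans_le (dimH_mono hA)
  rw [dimH_iUnion, lt_iSup_iff] at hlt
  obtain ⟨r, hr⟩ := hlt
  exact ⟨r, exists_isDyadicallyLarge hr⟩

lemma dimH_le_of_forall_hausdorffMeasure_eq_zero {ι : Type*} [Countable ι] {A : Set Plane}
    {F : ι → Set Plane} (hA : A ⊆ ⋃ i, F i) {t : NNReal} (hF : ∀ i, μH[t] (F i) = 0) :
    dimH A ≤ t := by
  refine (dimH_mono hA).trans ?_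
  rw [dimH_iUnion]
  exact iSup_le fun i => dimH_le_of_hausdorffMeasure_ne_top ((hF i).trans_ne ENNReal.zero_ne_top)

theorem dimH_setOf_le_dimH_visiblePart_le {Γ : Set Plane} (hΓ : IsPreconnected Γ) {s : ℝ}
    {t : NNReal} (hs₁ : 1 < s) (hs₂ : s ≤ 2) (ht₀ : 0 < t) (ht₁ : t ≤ 1)
    (ht : (dimH Γ).toReal - s < t * (s - 1)) :
    dimH {x | ENNReal.ofReal s ≤ dimH (visiblePart Γ x)} ≤ t := by
  set d := (dimH Γ).toReal
  obtain ⟨ε, hε₀, hε⟩ := exists_between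
    (show (0 : ℝ) < (t * (s - 1) + s - d) / 3 from div_pos (by linarith) three_pos)
  have hdε : 0 < d + ε := add_pos_of_nonneg_of_pos ENNReal.toReal_nonneg hε₀
  have hd : dimH Γ < ENNReal.ofReal (d + ε) :=
    (ENNReal.lt_ofReal_iff_toReal_lt (Real.dimH_ne_top Γ)).2 (lt_add_of_pos_right _ hε₀)
  refine dimH_le_of_forall_hausdorffMeasure_eq_zero
    (F := fun i : (ℕ × ℕ) × (ℤ × ℤ) => {x | gridIndex 0 x = i.2 ∧ IsDyadicallyLarge (s - ε) i.1.2
      (visiblePart Γ x ∩ Metric.closedBall x (2 ^ (i.1.1 + 1)))}) (fun x hx => ?_) fun i =>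
    hausdorffMeasure_eq_zero_of_isDyadicallyLarge hΓ hdε hd hs₁.le hs₂ ht₀ ht₁ hε₀.le
      ((lt_div_iff₀' three_pos).1 hε) (fun _ hx => hx.1) (by omega) fun _ hx => hx.2
  have hσ : ENNReal.ofReal (s - ε) < dimH (visiblePart Γ x) :=
    ((ENNReal.ofReal_lt_ofReal_iff (by linarith)).2 (sub_lt_self s hε₀)).trans_le hx
  obtain ⟨r, K₀, hlarge⟩ := exists_isDyadicallyLarge_inter_closedBall hσ x
  exact Set.mem_iUnion.2 ⟨((r, K₀), gridIndex 0 x), rfl, hlarge⟩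

lemma add_one_lt_two_mul_of_sqrt_lt {d s : ℝ} (hd₁ : 1 < d) (hd₂ : d ≤ 2)
    (hs : 1 / 2 + Real.sqrt (d - 3 / 4) < s) : d + 1 < 2 * s := by
  have hsqrt : d / 2 ≤ Real.sqrt (d - 3 / 4) := Real.le_sqrt_of_sq_le (by nlinarith)
  linarith

theorem theorem2_general {Γ : Set Plane} (hΓ : IsPreconnected Γ) {s : ℝ}
    (hs : (dimH Γ).toReal + 1 < 2 * s) (hs' : s ≤ (dimH Γ).toReal) :
    dimH {x | ENNReal.ofReal s ≤ dimH (visiblePart Γ x)} ≤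
      ENNReal.ofReal (((dimH Γ).toReal - s) / (s - 1)) := by
  have hs₁ : 1 < s := by linarith
  have hs₀ : 0 < s - 1 := sub_pos.2 hs₁
  have hbound : ((dimH Γ).toReal - s) / (s - 1) < 1 := (div_lt_one hs₀).2 (by linarith)
  have hbound₀ : 0 ≤ ((dimH Γ).toReal - s) / (s - 1) := div_nonneg (sub_nonneg.2 hs') hs₀.le
  by_contra! hlt
  obtain ⟨t, hbt, ht⟩ := ENNReal.lt_iff_exists_nnreal_btwn.1
    (lt_min hlt (ENNReal.ofReal_lt_one.2 hbound))
  rw [ENNReal.ofReal_lt_coe_iff hbound₀] at hbt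
  obtain ⟨htE, ht₁⟩ := lt_min_iff.1 ht
  exact htE.not_ge (dimH_setOf_le_dimH_visiblePart_le hΓ hs₁ (hs'.trans (dimH_toReal_le_two Γ))
    (hbound₀.trans_lt hbt) (ENNReal.coe_lt_one_iff.1 ht₁).le ((div_lt_iff₀ hs₀).1 hbt))

end Dimension

theorem theorem2 (Γ : Set (EuclideanSpace ℝ (Fin 2))) (hcompact : IsCompact Γ)
    (hconn : IsConnected Γ) (hdim : 1 < dimH Γ) (s : ℝ)
    (hs : 1 / 2 + Real.sqrt ((dimH Γ).toReal - 3 / 4) < s) (hs' : s ≤ (dimH Γ).toReal) :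
    dimH {x : EuclideanSpace ℝ (Fin 2) | ENNReal.ofReal s < dimH (visiblePart Γ x)} ≤
      ENNReal.ofReal (((dimH Γ).toReal - s) / (s - 1)) := by
  have hd : 1 < (dimH Γ).toReal :=
    (ENNReal.toReal_lt_toReal ENNReal.one_ne_top (Real.dimH_ne_top Γ)).2 hdim
  exact (dimH_mono (Set.ofPred_subset_ofPred.2 fun _ => le_of_lt)).trans (theorem2_general
    hconn.isPreconnected
    (add_one_lt_two_mul_of_sqrt_lt hd (dimH_toReal_le_two Γ) hs) hs')
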